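/- Let $p$ be a prime. Let $\mathcal G$ be a finite directed graph (loops and multiple edges allowed) whose edges are labeled by elements of an alphabet $\mathcal A$, let $v$ be a vertex of $\mathcal G$, and let $\bar f_p:\mathcal A\to\{0,1,\dots,p-1\}$. Let $Y\subseteq\mathbb Z_p$ be the set of all $\sum_{k\ge 0}\bar f_p(a_k)p^k$, where $(a_k)_{k\ge0}$ runs over the label sequences of the infinite directed walks in $\mathcal G$ that start at $v$. Suppose that this is a standard presentation of $Y$, that is: $\bar f_p$ is injective; at each vertex all exiting edges have different labels; and every vertex can be reached from $v$ by a directed path. Suppose also that $Y\neq\emptyset$. Write $d_H$ for Hausdorff dimension. (1) The map $\iota_p:\mathbb Z_p\to[0,1]$, $\iota_p\bigl(\sum_{k\ge0}\alpha_kp^k\bigr)=\sum_{k\ge0}\alpha_kp^{-k-1}$ (with digits $\alpha_k\in\{0,\dots,p-1\}$), is continuous, and $K_0:=\iota_p(Y)$ is a construction sub-object of a Mauldin–Williams graph-directed construction in $\mathbb R$ all of whose edge maps are similarities of ratio $1/p$. Here a Mauldin–Williams graph-directed construction in $\mathbb R$ consists of: compact sets $J_1,\dots,J_n\subset\mathbb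 R$ with nonempty interior such that $J_i\cap J_j$ has empty interior for $i\ne j$; a directed graph $G$ on $\{1,\dots,n\}$ with at most one edge from $i$ to $j$ for each pair $(i,j)$, in which every vertex has an exit edge and whose underlying undirected graph is connected; and for each edge $(i,j)$ a similarity $T_{i,j}:\mathbb R\to\mathbb R$ of ratio $t_{i,j}>0$, such that $T_{i,j}(J_j)\subseteq J_i$, for each $i$ the sets $T_{i,j}(J_j)$ with $(i,j)\in G$ have pairwise intersections with empty interior, and the product of the ratios along every directed cycle is less than $1$. Its construction sub-objects are the entries of the unique vector $(K_1,\dots,K_n)$ of nonempty compact sets $K_i\subseteq J_i$ with $K_i=\bigcup_{(i,j)\in G}T_{i,j}(K_j)$ for all $i$. (2) The map $\iota_p$ preserves Hausdorff dimension: $d_H(S)=d_H(\iota_p(S))$ for every $S\subseteq\mathbb Z_p$. In particular $d_H(Y)=d_H(K_0)$. (3) Let $A(\mathcal G)$ be the adjacency matrix, whose $(i,j)$ entry is the number of edges of $\mathcal G$ from $i$ to $j$, and let $\sigma(A(\mathcal G))$ be its spectral radius. Then $\sigma(A(\mathcal G))\ge1$ and $$d_H(Y)=d_H(K_0)=\log_p\sigma(A(\mathcal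 G)).$$ -/

import Mathlib

/-- A directed graph with vertex set `V` and edge set `E` (loops and multiple edges allowed),
whose edges are labeled by elements of `A`. -/
structure LabeledGraph (V E A : Type*) where
  src : E → V
  tgt : E → V
  label : E → A

namespace LabeledGraph

variable {V E A : Type*}

/-- The path set of the pointed graph `(G, v)`: the label sequences of all infinite walks
in `G` that start at `v`. -/
def pathSet (G : LabeledGraph V E A) (v : V) : Set (ℕ → A) :=
  {s | ∃ e : ℕ → E, G.src (e 0) = v ∧ (∀ k, G.tgt (e k) = G.src (e (k + 1))) ∧
    ∀ k, G.label (e k) = s k}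

/-- At each vertex, all exiting edges have different labels. -/
def RightResolving (G : LabeledGraph V E A) : Prop :=
  ∀ e e' : E, G.src e = G.src e' → G.label e = G.label e' → e = e'

/-- Every vertex can be reached by a directed path from `v`. -/
def ReachableFrom (G : LabeledGraph V E A) (v : V) : Prop :=
  ∀ w : V, Relation.ReflTransGen (fun a b => ∃ e : E, G.src e = a ∧ G.tgt e = b) v w

/-- The adjacency matrix: its `(i, j)` entry is the number of edges from `i` to `j`. -/
noncomputable def adjacency (G : LabeledGraph V E A) : Matrix V V ℕ :=
  Matrix.of fun i j => Nat.card {e : E // G.src e = i ∧ G.tgt e = j}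

/-- The spectral radius of the adjacency matrix: the largest absolute value of its
complex eigenvalues. -/
noncomputable def adjSpectralRadius [Fintype V] [DecidableEq V] (G : LabeledGraph V E A) : ℝ :=
  (spectralRadius ℂ (G.adjacency.map (Nat.cast : ℕ → ℂ))).toReal

end LabeledGraph

/-- The `p`-adic integer `∑ aₖ pᵏ` with digit sequence `a`. -/
noncomputable def padicOfDigits (p : ℕ) [Fact p.Prime] (a : ℕ → Fin p) : ℤ_[p] :=
  ∑' k, ((a k : ℕ) : ℤ_[p]) * (p : ℤ_[p]) ^ k

/-- The `k`-th `p`-adic digit of `x`; here `x.appr (k + 1)` is the representative of `x`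
modulo `p ^ (k + 1)` in `{0, …, p ^ (k + 1) - 1}`, and `/` is division with remainder. -/
noncomputable def padicDigit (p : ℕ) [Fact p.Prime] (x : ℤ_[p]) (k : ℕ) : ℕ :=
  x.appr (k + 1) / p ^ k

/-- The map `ℤ_p → ℝ` that sends `∑ αₖ pᵏ` to `∑ αₖ / p ^ (k + 1)`. -/
noncomputable def iotaP (p : ℕ) [Fact p.Prime] (x : ℤ_[p]) : ℝ :=
  ∑' k, (padicDigit p x k : ℝ) / (p : ℝ) ^ (k + 1)

/-- `(f, G, v)` is a presentation of `Y ⊆ ℤ_p` as a `p`-adic path set fractal, and it is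
standard: injective, right-resolving and reachable. -/
structure IsStandardPresentation (p : ℕ) [Fact p.Prime] {V E A : Type*} (f : A → Fin p)
    (G : LabeledGraph V E A) (v : V) (Y : Set ℤ_[p]) : Prop where
  presents : Y = (fun s : ℕ → A => padicOfDigits p (fun k => f (s k))) '' G.pathSet v
  injective : Function.Injective f
  rightResolving : G.RightResolving
  reachable : G.ReachableFrom v

/-- Two sets overlap if their intersection has nonempty interior. -/
def Overlap {X : Type*} [TopologicalSpace X] (S T : Set X) : Prop :=
  (interior (S ∩ T)).Nonempty

/-- A Mauldin–Williams geometric graph-directed construction in the Euclidean space `X`, with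
vertices `0, …, n - 1`. The graph has at most one edge from `i` to `j`; `T i j` and `t i j` matter
only if `(i, j)` is an edge. -/
structure GraphDirectedConstruction (X : Type*) [NormedAddCommGroup X] [InnerProductSpace ℝ X]
    [FiniteDimensional ℝ X] (n : ℕ) where
  J : Fin n → Set X
  graph : Digraph (Fin n)
  T : Fin n → Fin n → X → X
  t : Fin n → Fin n → ℝ
  isCompact_J : ∀ i, IsCompact (J i)
  interior_J : ∀ i, (interior (J i)).Nonempty
  nonoverlap_J : ∀ i j, i ≠ j → ¬ Overlap (J i) (J j)
  exit_edge : ∀ i, ∃ j, graph.Adj i j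
  connected : (SimpleGraph.fromRel graph.Adj).Connected
  ratio_pos : ∀ i j, graph.Adj i j → 0 < t i j
  similarity : ∀ i j, graph.Adj i j → ∀ x y, dist (T i j x) (T i j y) = t i j * dist x y
  nonoverlap_T : ∀ i j k, graph.Adj i j → graph.Adj i k → j ≠ k →
    ¬ Overlap (T i j '' J j) (T i k '' J k)
  image_subset : ∀ i j, graph.Adj i j → T i j '' J j ⊆ J i
  /-- The product of the ratios along every directed cycle is less than `1`. -/
  cycle_contract : ∀ (q : ℕ) (c : ℕ → Fin n), 0 < q → c q = c 0 →
    (∀ k < q, graph.Adj (c k) (c (k + 1))) → ∏ k ∈ Finset.range q, t (c k) (c (k + 1)) < 1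

namespace GraphDirectedConstruction

variable {X : Type*} [NormedAddCommGroup X] [InnerProductSpace ℝ X] [FiniteDimensional ℝ X]
  {n : ℕ}

/-- `K` is a vector of nonempty compact sets `K i ⊆ J i` that satisfies
`K i = ⋃ {T i j (K j) | (i, j) an edge}` for all `i`. -/
structure IsInvariant (C : GraphDirectedConstruction X n) (K : Fin n → Set X) : Prop where
  isCompact : ∀ i, IsCompact (K i)
  nonempty : ∀ i, (K i).Nonempty
  subset : ∀ i, K i ⊆ C.J i
  eq_iUnion : ∀ i, K i = ⋃ (j : Fin n) (_ : C.graph.Adj i j), C.T i j '' K j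

/-- `S` is the construction sub-object at the vertex `i`: the `i`-th entry of the unique
invariant vector of nonempty compact sets. -/
def IsSubobject (C : GraphDirectedConstruction X n) (i : Fin n) (S : Set X) : Prop :=
  ∃ K : Fin n → Set X, C.IsInvariant K ∧ (∀ K', C.IsInvariant K' → K' = K) ∧ K i = S

end GraphDirectedConstruction

/-! Dimension under `iotaP`: digit strings with a common prefix of length n have images within p⁻ⁿ,
so the map is 1-Lipschitz. Conversely a real set of diameter at most p⁻ᵏ meets at most five
cylinders of level k, so covers pull back at bounded cost (`dimH_le_dimH_image_of_preimage_cover`).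

Dimension formula, upper bound (`dimH_padicPathSet_le`): the paths of length m from v index a cover
by cylinders of diameter at most p⁻ᵐ. Their number is a row sum of the m-th power of the adjacency
matrix, hence at most p^(dm) for large m once p^d exceeds the spectral radius σ.

Lower bound: the trace of the m-th power is the sum of the m-th powers of the eigenvalues. For
suitable large m these all have nonnegative real part and cannot cancel, so for r < σ some diagonal
entry is at least rᵐ (`Matrix.exists_pow_le_pow_diag`). The loops it counts concatenate freely, and
injective digits with right-resolving edges keep them distinguishable. The path set at that vertex
thus contains a full shift on at least rᵐ symbols with block length m, of dimension at least log_p r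
(`le_dimH_range_of_separated`). Reachability carries this bound back to v.

Graph-directed construction: its vertices are an initial state and the edges of G that some infinite
walk continues. A transition is then determined by its end states and its digit by the target, so
parallel edges cause no trouble. The sub-objects are translates of sets of base-p reals read along
walks; uniqueness is contraction by 1/p. -/

open Filter Topology
open scoped NNReal ENNReal

/-! ### Traces and growth of powers of nonnegative integer matrices -/

section LinearAlgebra

open Polynomial

variable {ι : Type*} [Fintype ι] [DecidableEq ι]

/-- Both sides are multiplicative in q, so constants and monic linear factors suffice; for these it
is the factorization of the characteristic polynomial. -/
theorem Matrix.det_aeval_eq_prod_roots_charpoly {K : Type*} [Field K] [IsAlgClosed K]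
    (M : Matrix ι ι K) (q : K[X]) :
    (aeval M q).det = (M.charpoly.roots.map fun r => q.eval r).prod := by
  have hcard : Multiset.card M.charpoly.roots = Fintype.card ι := by
    rw [IsAlgClosed.card_roots_eq_natDegree, M.charpoly_natDegree_eq_dim]
  let F : K[X] →* K :=
    Matrix.detMonoidHom.comp (aeval M : K[X] →ₐ[K] Matrix ι ι K).toRingHom.toMonoidHom
  let H : K[X] →* K :=
    { toFun := fun q => (M.charpoly.roots.map fun r => q.eval r).prod
      map_one' := by simp
      map_mul' := fun a b => by simp [Multiset.prod_map_mul] }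
  have hC : ∀ a, F (C a) = H (C a) := fun a => by
    simp [F, H, hcard, Matrix.algebraMap_eq_diagonal]
  have hX : ∀ a, F (X - C a) = H (X - C a) := fun a => by
    have h1 : M.charpoly.eval a = (M.charpoly.roots.map fun r => a - r).prod := by
      conv_lhs => rw [(IsAlgClosed.splits M.charpoly).eq_prod_roots_of_monic M.charpoly_monic]
      simp [eval_multiset_prod, Multiset.map_map]
    have h2 : (M - algebraMap K _ a).det = (-1) ^ Fintype.card ι * M.charpoly.eval a := by
      rw [Matrix.eval_charpoly, ← Matrix.det_neg, neg_sub]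
      rfl
    have h3 : (M.charpoly.roots.map fun r => r - a).prod =
        (-1) ^ Fintype.card ι * (M.charpoly.roots.map fun r => a - r).prod := by
      rw [← hcard, ← Multiset.card_map (fun r => a - r), ← Multiset.prod_map_neg]
      simp [Multiset.map_map]
    simpa [F, H, h3, h1] using h2
  change F q = H q
  rw [(IsAlgClosed.splits q).eq_prod_roots, map_mul, map_mul, hC, map_multiset_prod,
    map_multiset_prod, Multiset.map_map, Multiset.map_map]
  simp only [Function.comp_def, hX]

theorem Matrix.roots_charpoly_pow {K : Type*} [Field K] [IsAlgClosed K]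
    (M : Matrix ι ι K) (m : ℕ) :
    (M ^ m).charpoly.roots = M.charpoly.roots.map (· ^ m) := by
  have : (M ^ m).charpoly = ((M.charpoly.roots.map (· ^ m)).map fun r => X - C r).prod := by
    refine Polynomial.funext fun c => ?_
    -- With q = c - Xᵐ the determinant is the characteristic polynomial of `M ^ m` at c.
    have h := M.det_aeval_eq_prod_roots_charpoly (C c - X ^ m)
    rw [Matrix.eval_charpoly]
    simp only [eval_multiset_prod, Multiset.map_map, Function.comp_def, eval_sub, eval_X, eval_C]
    simpa [Matrix.algebraMap_eq_diagonal, Pi.algebraMap_def] using h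
  rw [this, roots_multiset_prod_X_sub_C]

theorem Matrix.trace_pow_eq_sum_roots_charpoly {K : Type*} [Field K] [IsAlgClosed K]
    (M : Matrix ι ι K) (m : ℕ) :
    (M ^ m).trace = (M.charpoly.roots.map (· ^ m)).sum := by
  rw [Matrix.trace_eq_sum_roots_charpoly, Matrix.roots_charpoly_pow]

/-- Simultaneous recurrence: the arguments of the powers of finitely many complex numbers return
close to `0` infinitely often. -/
theorem Complex.exists_pow_re_ge (s : Finset ℂ) (N : ℕ) :
    ∃ m, N ≤ m ∧ 1 ≤ m ∧ ∀ z ∈ s, ‖z‖ ^ m / 2 ≤ (z ^ m).re := by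
  -- Powers of the unit directions z/‖z‖, bounded and hence with a Cauchy subsequence. Division by
  -- zero makes the direction of 0 equal to 0; that case is split off below.
  let u : ℕ → (s → ℂ) := fun n z => ((z : ℂ) / ‖(z : ℂ)‖) ^ n
  have hle : ∀ z : ℂ, ‖z / ‖z‖‖ ≤ 1 := fun z => by
    rw [norm_div, Complex.norm_real, norm_norm]
    exact div_self_le_one _
  have hu : ∀ n, u n ∈ Metric.closedBall (0 : s → ℂ) 1 := fun n => by
    rw [mem_closedBall_zero_iff, pi_norm_le_iff_of_nonneg zero_le_one]
    intro z
    rw [norm_pow]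
    exact pow_le_one₀ (norm_nonneg _) (hle z)
  obtain ⟨a, -, φ, hφ, hlim⟩ := tendsto_subseq_of_bounded Metric.isBounded_closedBall hu
  obtain ⟨K, hK⟩ := Metric.cauchySeq_iff.1 hlim.cauchySeq (1 / 2) (by norm_num)
  -- The exponent m is the gap between two close terms of the subsequence; a strictly increasing φ
  -- makes it at least N + 1.
  have hlt : φ K + (N + 1) ≤ φ (K + (N + 1)) := by
    have := hφ.add_le_nat (N + 1) K
    rwa [add_comm (N + 1) K, add_comm (N + 1)] at this
  obtain ⟨m, hm⟩ := Nat.exists_eq_add_of_le (le_of_add_le_left hlt)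
  refine ⟨m, by omega, by omega, fun z hz => ?_⟩
  rcases eq_or_ne z 0 with rfl | hz0
  · have : m ≠ 0 := by omega
    simp [this]
  have hn : 0 < ‖z‖ := norm_pos_iff.2 hz0
  set w : ℂ := z / ‖z‖ with hw
  have hw1 : ‖w‖ = 1 := by
    rw [hw, norm_div, Complex.norm_real, norm_norm, div_self hn.ne']
  have h1 : ‖w ^ (φ K + m) - w ^ φ K‖ < 1 / 2 := by
    have := (dist_le_pi_dist _ _ ⟨z, hz⟩).trans_lt (hK (K + (N + 1)) (by omega) K le_rfl)
    rw [dist_eq_norm] at this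
    simpa only [u, Function.comp, hm] using this
  -- As w is unimodular, the common factor w ^ φ K can be divided out.
  have h2 : ‖w ^ m - 1‖ < 1 / 2 := by
    have : w ^ (φ K + m) - w ^ φ K = w ^ φ K * (w ^ m - 1) := by ring
    rwa [this, norm_mul, norm_pow, hw1, one_pow, one_mul] at h1
  have h3 : 1 / 2 ≤ (w ^ m).re := by
    have := (Complex.abs_re_le_norm (w ^ m - 1)).trans h2.le
    rw [Complex.sub_re, Complex.one_re, abs_le] at this
    linarith [this.1]
  have h4 : z ^ m = ((‖z‖ ^ m : ℝ) : ℂ) * w ^ m := by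
    rw [hw, div_pow, Complex.ofReal_pow, mul_div_cancel₀]
    exact pow_ne_zero _ (by exact_mod_cast hn.ne')
  rw [h4, Complex.re_ofReal_mul]
  nlinarith [pow_pos hn m]

/-- The spectral radius of a matrix of natural numbers, as a complex matrix. -/
noncomputable def Matrix.natSpectralRadius (B : Matrix ι ι ℕ) : ℝ :=
  (spectralRadius ℂ (B.map (Nat.cast : ℕ → ℂ))).toReal

section NormedMatrix

attribute [local instance] Matrix.linftyOpNormedRing Matrix.linftyOpNormedAlgebra

theorem Matrix.map_natCast_pow {R : Type*} [Semiring R] (B : Matrix ι ι ℕ) (m : ℕ) :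
    (B ^ m).map (Nat.cast : ℕ → R) = B.map (Nat.cast : ℕ → R) ^ m :=
  map_pow (Nat.castRingHom R).mapMatrix B m

theorem Matrix.spectralRadius_ne_top [Nonempty ι] (M : Matrix ι ι ℂ) :
    spectralRadius ℂ M ≠ ⊤ := by
  have : CompleteSpace (Matrix ι ι ℂ) := FiniteDimensional.complete ℂ _
  obtain ⟨z, -, hz⟩ := spectrum.exists_nnnorm_eq_spectralRadius M
  rw [← hz]
  exact ENNReal.coe_ne_top

theorem Matrix.exists_norm_eq_natSpectralRadius [Nonempty ι] (B : Matrix ι ι ℕ) :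
    ∃ z ∈ spectrum ℂ (B.map (Nat.cast : ℕ → ℂ)), ‖z‖ = B.natSpectralRadius := by
  have : CompleteSpace (Matrix ι ι ℂ) := FiniteDimensional.complete ℂ _
  obtain ⟨z, hz, h⟩ := spectrum.exists_nnnorm_eq_spectralRadius (B.map (Nat.cast : ℕ → ℂ))
  exact ⟨z, hz, by rw [Matrix.natSpectralRadius, ← h]; simp⟩

/-- Powers of a matrix of natural numbers grow at most like powers of any number above the
spectral radius. -/
theorem Matrix.eventually_sum_pow_le [Nonempty ι] (B : Matrix ι ι ℕ) {r : ℝ}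
    (hr : B.natSpectralRadius < r) :
    ∀ᶠ m : ℕ in atTop, ∀ i, ((∑ j, (B ^ m) i j : ℕ) : ℝ) ≤ r ^ m := by
  have : CompleteSpace (Matrix ι ι ℂ) := FiniteDimensional.complete ℂ _
  have hr0 : 0 ≤ r := ENNReal.toReal_nonneg.trans hr.le
  have hlt : spectralRadius ℂ (B.map (Nat.cast : ℕ → ℂ)) < ENNReal.ofReal r :=
    (ENNReal.lt_ofReal_iff_toReal_lt (Matrix.spectralRadius_ne_top _)).2 hr
  filter_upwards [(spectrum.pow_norm_pow_one_div_tendsto_nhds_spectralRadius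
    (B.map (Nat.cast : ℕ → ℂ))).eventually_lt_const hlt, eventually_ge_atTop 1] with m hm hm1 i
  have hm0 : (m : ℝ) ≠ 0 := by positivity
  have h1 : ‖B.map (Nat.cast : ℕ → ℂ) ^ m‖ ≤ r ^ m := by
    have h2 := ENNReal.lt_ofReal_iff_toReal_lt ENNReal.ofReal_ne_top |>.1 hm
    rw [ENNReal.toReal_ofReal (by positivity)] at h2
    have h3 := pow_le_pow_left₀ (by positivity) h2.le m
    rwa [← Real.rpow_natCast, ← Real.rpow_mul (norm_nonneg _), one_div, inv_mul_cancel₀ hm0,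
      Real.rpow_one] at h3
  refine le_trans ?_ h1
  rw [← Matrix.map_natCast_pow, ← coe_nnnorm, Matrix.linfty_opNNNorm_def]
  have h4 := Finset.le_sup (f := fun i => ∑ j, ‖((B ^ m).map (Nat.cast : ℕ → ℂ)) i j‖₊)
    (Finset.mem_univ i)
  refine le_trans ?_ (NNReal.coe_le_coe.2 h4)
  simp

/-- A spectral radius below 1 would push the entries of high powers below 1, and natural numbers
below 1 vanish. -/
theorem Matrix.one_le_natSpectralRadius [Nonempty ι] (B : Matrix ι ι ℕ)
    (h : ∃ᶠ m : ℕ in atTop, ∃ i j, 1 ≤ (B ^ m) i j) : 1 ≤ B.natSpectralRadius := by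
  by_contra! hlt
  obtain ⟨r, hr, hr1⟩ := exists_between hlt
  have hr0 : 0 ≤ r := ENNReal.toReal_nonneg.trans hr.le
  obtain ⟨m, ⟨i, j, hij⟩, hm, hm1⟩ := (h.and_eventually
    ((B.eventually_sum_pow_le hr).and (eventually_ge_atTop 1))).exists
  have h1 : 1 ≤ ∑ j, (B ^ m) i j :=
    hij.trans (Finset.single_le_sum (f := fun j => (B ^ m) i j) (fun _ _ => Nat.zero_le _)
      (Finset.mem_univ j))
  have h2 : (1 : ℝ) ≤ r ^ m := le_trans (by exact_mod_cast h1) (hm i)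
  exact (pow_lt_one₀ hr0 hr1 (by omega)).not_ge h2

/-- Diagonal entries of powers of a matrix of natural numbers grow infinitely often at least like
powers of any number below the spectral radius. -/
theorem Matrix.exists_pow_le_pow_diag [Nonempty ι] (B : Matrix ι ι ℕ) {r : ℝ} (hr0 : 0 < r)
    (hr : r < B.natSpectralRadius) :
    ∃ m, 1 ≤ m ∧ ∃ i, r ^ m ≤ ((B ^ m) i i : ℝ) := by
  set M := B.map (Nat.cast : ℕ → ℂ) with hM
  obtain ⟨z, hz, hzn⟩ := B.exists_norm_eq_natSpectralRadius
  rw [← hzn] at hr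
  have hzr : z ∈ M.charpoly.roots :=
    (mem_roots M.charpoly_monic.ne_zero).2 (Matrix.mem_spectrum_iff_isRoot_charpoly.1 hz)
  -- The 2 absorbs the loss in the recurrence lemma; the cardinality absorbs averaging the trace
  -- over the diagonal.
  have hgrow : ∀ᶠ m : ℕ in atTop, 2 * (Fintype.card ι : ℝ) ≤ (‖z‖ / r) ^ m :=
    (tendsto_pow_atTop_atTop_of_one_lt ((one_lt_div hr0).2 hr)).eventually_ge_atTop _
  obtain ⟨N, hN⟩ := eventually_atTop.1 hgrow
  obtain ⟨m, hmN, hm1, hm⟩ := Complex.exists_pow_re_ge M.charpoly.roots.toFinset N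
  refine ⟨m, hm1, ?_⟩
  have htr : (∑ i, ((B ^ m) i i : ℝ)) = ((M.charpoly.roots.map fun y => (y ^ m).re).sum) := by
    have h := M.trace_pow_eq_sum_roots_charpoly m
    rw [hM, ← Matrix.map_natCast_pow, ← hM] at h
    have h' := congrArg Complex.reAddGroupHom h
    rw [map_multiset_sum, Multiset.map_map] at h'
    simpa [Matrix.trace, Function.comp_def] using h'
  have hge : ‖z‖ ^ m / 2 ≤ (M.charpoly.roots.map fun y => (y ^ m).re).sum := by
    refine (hm z (Multiset.mem_toFinset.2 hzr)).trans ?_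
    refine Multiset.single_le_sum ?_ _ (Multiset.mem_map_of_mem _ hzr)
    intro x hx
    obtain ⟨y, hy, rfl⟩ := Multiset.mem_map.1 hx
    exact le_trans (by positivity) (hm y (Multiset.mem_toFinset.2 hy))
  by_contra! hcon
  have hlt : (∑ i, ((B ^ m) i i : ℝ)) < Fintype.card ι * r ^ m := by
    have := Finset.sum_lt_sum_of_nonempty (s := Finset.univ) Finset.univ_nonempty
      fun i _ => hcon i
    simpa using this
  have h5 := hN m hmN
  rw [div_pow, le_div_iff₀ (pow_pos hr0 m)] at h5
  linarith

end NormedMatrix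

end LinearAlgebra

/-! ### Base-p digits of p-adic integers and of their images -/

section Digits

variable {p : ℕ} [hp : Fact p.Prime]

theorem padicTerm_norm_le (a : ℕ → Fin p) (k : ℕ) :
    ‖((a k : ℕ) : ℤ_[p]) * (p : ℤ_[p]) ^ k‖ ≤ ((p : ℝ)⁻¹) ^ k := by
  rw [norm_mul, norm_pow, PadicInt.norm_p]
  exact mul_le_of_le_one_left (by positivity) (PadicInt.norm_le_one _)

theorem summable_padicTerm (a : ℕ → Fin p) :
    Summable fun k => ((a k : ℕ) : ℤ_[p]) * (p : ℤ_[p]) ^ k :=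
  Summable.of_norm_bounded (summable_geometric_of_lt_one (by positivity)
    (inv_lt_one_of_one_lt₀ (by exact_mod_cast hp.out.one_lt))) (padicTerm_norm_le a)

theorem padicOfDigits_eq_sum_add (a : ℕ → Fin p) (n : ℕ) :
    padicOfDigits p a = ((∑ k ∈ Finset.range n, (a k : ℕ) * p ^ k : ℕ) : ℤ_[p]) +
      (p : ℤ_[p]) ^ n * padicOfDigits p (fun k => a (k + n)) := by
  rw [padicOfDigits, padicOfDigits, ← (summable_padicTerm a).sum_add_tsum_nat_add n,
    ← (summable_padicTerm fun k => a (k + n)).tsum_mul_left]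
  push_cast
  congr 2
  ext k
  ring

theorem sum_digits_lt_pow (a : ℕ → Fin p) (n : ℕ) :
    ∑ k ∈ Finset.range n, (a k : ℕ) * p ^ k < p ^ n := by
  induction n with
  | zero => simp
  | succ n ih =>
    rw [Finset.sum_range_succ, pow_succ]
    have := (a n).2
    nlinarith [pow_pos hp.out.pos n]

theorem PadicInt.natCast_eq_of_sub_mem_span {n x y : ℕ} (hx : x < p ^ n) (hy : y < p ^ n)
    (h : (x : ℤ_[p]) - y ∈ Ideal.span {(p : ℤ_[p]) ^ n}) : x = y := by
  have h1 : ((x : ℤ) : ℤ_[p]) - ((y : ℤ) : ℤ_[p]) ∈ Ideal.span {(p : ℤ_[p]) ^ n} := by simpa using h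
  rw [← PadicInt.norm_le_pow_iff_mem_span_pow, ← Int.cast_sub,
    PadicInt.norm_int_le_pow_iff_dvd] at h1
  have h2 : (y : ℤ) ≡ x [ZMOD (p ^ n : ℕ)] := by
    rw [Int.modEq_iff_dvd]; exact_mod_cast h1
  have h3 := (Int.natCast_modEq_iff.1 h2).symm
  rwa [Nat.ModEq, Nat.mod_eq_of_lt hx, Nat.mod_eq_of_lt hy] at h3

theorem appr_padicOfDigits (a : ℕ → Fin p) (n : ℕ) :
    (padicOfDigits p a).appr n = ∑ k ∈ Finset.range n, (a k : ℕ) * p ^ k := by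
  refine PadicInt.natCast_eq_of_sub_mem_span (PadicInt.appr_lt _ n) (sum_digits_lt_pow a n) ?_
  have h1 := PadicInt.appr_spec n (padicOfDigits p a)
  have h2 : padicOfDigits p a - ((∑ k ∈ Finset.range n, (a k : ℕ) * p ^ k : ℕ) : ℤ_[p]) ∈
      Ideal.span {(p : ℤ_[p]) ^ n} := by
    rw [padicOfDigits_eq_sum_add a n, add_sub_cancel_left]
    exact Ideal.mul_mem_right _ _ (Ideal.mem_span_singleton_self _)
  have := sub_mem h2 h1
  rwa [sub_sub_sub_cancel_left] at this

theorem padicDigit_padicOfDigits (a : ℕ → Fin p) (k : ℕ) :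
    padicDigit p (padicOfDigits p a) k = a k := by
  rw [padicDigit, appr_padicOfDigits, Finset.sum_range_succ,
    Nat.add_mul_div_right _ _ (pow_pos hp.out.pos k),
    Nat.div_eq_of_lt (sum_digits_lt_pow a k), zero_add]

theorem padicDigit_lt (x : ℤ_[p]) (k : ℕ) : padicDigit p x k < p := by
  rw [padicDigit, Nat.div_lt_iff_lt_mul (pow_pos hp.out.pos k), mul_comm, ← pow_succ]
  exact PadicInt.appr_lt _ _

/-- The digit sequence of a `p`-adic integer. -/
noncomputable def padicDigits (x : ℤ_[p]) (k : ℕ) : Fin p := ⟨padicDigit p x k, padicDigit_lt x k⟩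

@[simp]
theorem padicDigits_padicOfDigits (a : ℕ → Fin p) : padicDigits (padicOfDigits p a) = a :=
  funext fun k => Fin.ext (padicDigit_padicOfDigits a k)

theorem sum_padicDigits (x : ℤ_[p]) (n : ℕ) :
    ∑ k ∈ Finset.range n, (padicDigits x k : ℕ) * p ^ k = x.appr n := by
  induction n with
  | zero => simp [PadicInt.appr]
  | succ n ih =>
    rw [Finset.sum_range_succ, ih]
    obtain ⟨c, hc⟩ := PadicInt.dvd_appr_sub_appr x n (n + 1) n.le_succ
    have h1 : x.appr (n + 1) = x.appr n + p ^ n * c := by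
      have : x.appr n ≤ x.appr (n + 1) := PadicInt.appr_mono x n.le_succ
      omega
    have h2 : (padicDigits x n : ℕ) = c := by
      change x.appr (n + 1) / p ^ n = c
      rw [h1, Nat.add_mul_div_left _ _ (pow_pos hp.out.pos n),
        Nat.div_eq_of_lt (PadicInt.appr_lt _ _), zero_add]
    rw [h1, h2, mul_comm]

@[simp]
theorem padicOfDigits_padicDigits (x : ℤ_[p]) : padicOfDigits p (padicDigits x) = x := by
  rw [← sub_eq_zero, ← norm_eq_zero]
  refine le_antisymm (le_of_forall_pos_lt_add fun ε hε => ?_) (norm_nonneg _)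
  obtain ⟨n, hn⟩ := exists_pow_lt_of_lt_one hε
    (inv_lt_one_of_one_lt₀ (show (1 : ℝ) < p by exact_mod_cast hp.out.one_lt))
  have h1 := PadicInt.appr_spec n (padicOfDigits p (padicDigits x))
  rw [appr_padicOfDigits, sum_padicDigits] at h1
  have h2 := sub_mem h1 (PadicInt.appr_spec n x)
  rw [sub_sub_sub_cancel_right, ← PadicInt.norm_le_pow_iff_mem_span_pow] at h2
  rw [zero_add]
  refine h2.trans_lt ?_
  rwa [zpow_neg, zpow_natCast, ← inv_pow]

/-- The dictionary between p-adic balls and cylinders of digit sequences on which all metric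
estimates rest. -/
theorem norm_padicOfDigits_sub_le_iff (a b : ℕ → Fin p) (n : ℕ) :
    ‖padicOfDigits p a - padicOfDigits p b‖ ≤ ((p : ℝ) ^ n)⁻¹ ↔ ∀ k < n, a k = b k := by
  rw [← zpow_natCast, ← zpow_neg, PadicInt.norm_le_pow_iff_mem_span_pow]
  constructor
  · intro h
    have key : ∀ m ≤ n, (padicOfDigits p a).appr m = (padicOfDigits p b).appr m := by
      intro m hm
      refine PadicInt.natCast_eq_of_sub_mem_span (PadicInt.appr_lt _ m) (PadicInt.appr_lt _ m) ?_
      have h' : padicOfDigits p a - padicOfDigits p b ∈ Ideal.span {(p : ℤ_[p]) ^ m} :=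
        Ideal.span_singleton_le_span_singleton.2 (pow_dvd_pow _ hm) h
      have h1 := PadicInt.appr_spec m (padicOfDigits p a)
      have h2 := PadicInt.appr_spec m (padicOfDigits p b)
      have h3 := sub_mem (add_mem h' h2) h1
      convert h3 using 1
      ring
    intro k hk
    refine Fin.ext ?_
    rw [← padicDigit_padicOfDigits a, ← padicDigit_padicOfDigits b, padicDigit, padicDigit,
      key (k + 1) hk]
  · intro h
    rw [padicOfDigits_eq_sum_add a n, padicOfDigits_eq_sum_add b n,
      Finset.sum_congr rfl fun k hk => by rw [h k (Finset.mem_range.1 hk)],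
      add_sub_add_left_eq_sub, ← mul_sub]
    exact Ideal.mul_mem_right _ _ (Ideal.mem_span_singleton_self _)

theorem norm_sub_le_iff_padicDigits (x y : ℤ_[p]) (n : ℕ) :
    ‖x - y‖ ≤ ((p : ℝ) ^ n)⁻¹ ↔ ∀ k < n, padicDigits x k = padicDigits y k := by
  rw [← norm_padicOfDigits_sub_le_iff, padicOfDigits_padicDigits, padicOfDigits_padicDigits]

theorem iotaP_eq_ofDigits (x : ℤ_[p]) : iotaP p x = Real.ofDigits (padicDigits x) := by
  simp [iotaP, Real.ofDigits, Real.ofDigitsTerm, padicDigits, div_eq_mul_inv]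

theorem iotaP_padicOfDigits (a : ℕ → Fin p) : iotaP p (padicOfDigits p a) = Real.ofDigits a := by
  rw [iotaP_eq_ofDigits, padicDigits_padicOfDigits]

theorem lipschitzWith_iotaP : LipschitzWith 1 (iotaP p) := by
  refine LipschitzWith.of_dist_le_mul fun x y => ?_
  rw [NNReal.coe_one, one_mul, Real.dist_eq, dist_eq_norm, iotaP_eq_ofDigits, iotaP_eq_ofDigits]
  rcases eq_or_ne x y with rfl | hxy
  · simp
  have h := PadicInt.norm_eq_zpow_neg_valuation (sub_ne_zero.2 hxy)
  rw [zpow_neg, zpow_natCast] at h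
  rw [h]
  exact Real.abs_ofDigits_sub_ofDigits_le ((norm_sub_le_iff_padicDigits x y _).1 h.le)

end Digits

/-! ### A covering criterion for not decreasing Hausdorff dimension -/

section HausdorffDimension

open MeasureTheory Metric

/-- Rounds a diameter up to a power of β at the cost of a factor β⁻ᵈ. The error δ serves only x = 0,
which no power of β approximates within a factor. -/
theorem ENNReal.exists_pow_near_rpow_le {β : ℝ≥0} (hβ0 : 0 < β) (hβ1 : β < 1) {d : ℝ} (hd : 0 < d)
    {x : ℝ≥0∞} {K : ℕ} (hx : x ≤ ((β ^ K : ℝ≥0) : ℝ≥0∞)) {δ : ℝ≥0∞} (hδ : 0 < δ) :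
    ∃ k, K ≤ k ∧ x ≤ ((β ^ k : ℝ≥0) : ℝ≥0∞) ∧
      ((β ^ k : ℝ≥0) : ℝ≥0∞) ^ d ≤ ((β⁻¹ : ℝ≥0) : ℝ≥0∞) ^ d * x ^ d + δ := by
  lift x to ℝ≥0 using ne_top_of_le_ne_top ENNReal.coe_ne_top hx
  rw [ENNReal.coe_le_coe] at hx
  rcases eq_or_ne x 0 with rfl | hx0
  · have h1 : Tendsto (fun k : ℕ => ((β ^ k : ℝ≥0) : ℝ≥0∞) ^ d) atTop (𝓝 0) := by
      have h2 : Tendsto (fun k : ℕ => ((β ^ k : ℝ≥0) : ℝ≥0∞)) atTop (𝓝 ((0 : ℝ≥0) : ℝ≥0∞)) :=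
        ENNReal.tendsto_coe.2 (NNReal.tendsto_pow_atTop_nhds_zero_of_lt_one hβ1)
      have h3 := ((ENNReal.continuous_rpow_const (y := d)).tendsto _).comp h2
      simpa [Function.comp_def, ENNReal.zero_rpow_of_pos hd] using h3
    obtain ⟨k, hk, hk'⟩ := ((h1.eventually_le_const hδ).and (eventually_ge_atTop K)).exists
    exact ⟨k, hk', by simp, hk.trans le_add_self⟩
  · obtain ⟨k, hk1, hk2⟩ := exists_nat_pow_near_of_lt_one (pos_iff_ne_zero.2 hx0)
      (hx.trans (pow_le_one₀ zero_le hβ1.le)) hβ0 hβ1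
    refine ⟨k, ?_, by exact_mod_cast hk2, le_add_right ?_⟩
    · have := (pow_lt_pow_iff_right_of_lt_one₀ hβ0 hβ1).1 (hk1.trans_le hx)
      omega
    · rw [← ENNReal.mul_rpow_of_nonneg _ _ hd.le]
      refine ENNReal.rpow_le_rpow ?_ hd.le
      rw [← ENNReal.coe_mul, ENNReal.coe_le_coe]
      calc β ^ k = β⁻¹ * β ^ (k + 1) := by
            rw [pow_succ', inv_mul_cancel_left₀ hβ0.ne']
        _ ≤ β⁻¹ * x := by gcongr

/-- If the preimage under `f` of a set of diameter at most `β ^ k` is covered by a bounded number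
of sets of diameter at most `β ^ k`, then `f` does not decrease Hausdorff dimension. -/
theorem dimH_le_dimH_image_of_preimage_cover {X Y : Type*} [EMetricSpace X] [EMetricSpace Y]
    (f : X → Y) {β : ℝ≥0} (hβ0 : 0 < β) (hβ1 : β < 1) (N : ℕ)
    (h : ∀ (U : Set Y) (k : ℕ), U.Nonempty → ediam U ≤ ((β ^ k : ℝ≥0) : ℝ≥0∞) →
      ∃ B : Fin N → Set X, f ⁻¹' U ⊆ ⋃ j, B j ∧ ∀ j, ediam (B j) ≤ ((β ^ k : ℝ≥0) : ℝ≥0∞))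
    (S : Set X) : dimH S ≤ dimH (f '' S) := by
  borelize X Y
  refine le_of_forall_gt_imp_ge_of_dense fun c hc => ?_
  obtain ⟨d, hd1, hd2⟩ := ENNReal.lt_iff_exists_nnreal_btwn.1 hc
  refine le_trans ?_ hd2.le
  have hd0 : (0 : ℝ) < d := by
    have : (0 : ℝ≥0∞) < d := zero_le.trans_lt hd1
    exact_mod_cast this
  have hzero := hausdorffMeasure_of_dimH_lt hd1
  set c₁ : ℝ≥0∞ := ((β⁻¹ : ℝ≥0) : ℝ≥0∞) ^ (d : ℝ) with hc₁
  have hc₁top : c₁ ≠ ∞ := ENNReal.rpow_ne_top_of_nonneg hd0.le ENNReal.coe_ne_top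
  have step : ∀ K : ℕ, ∃ t : ℕ × Fin N → Set X, S ⊆ ⋃ i, t i ∧
      (∀ i, ediam (t i) ≤ ((β ^ K : ℝ≥0) : ℝ≥0∞)) ∧
      ∑' i, ediam (t i) ^ (d : ℝ) ≤ N * (c₁ + 1) * ((β ^ K : ℝ≥0) : ℝ≥0∞) := by
    intro K
    set η : ℝ≥0∞ := ((β ^ K : ℝ≥0) : ℝ≥0∞) with hη
    have hη0 : 0 < η := ENNReal.coe_pos.2 (pow_pos hβ0 K)
    -- Measure zero makes the infimum over η-fine covers zero, so some cover has sum below η.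
    obtain ⟨t, hcov, hdiam, hsum⟩ : ∃ t : ℕ → Set Y, f '' S ⊆ ⋃ n, t n ∧ (∀ n, ediam (t n) ≤ η) ∧
        ∑' n, ⨆ _ : (t n).Nonempty, ediam (t n) ^ (d : ℝ) < η := by
      rw [Measure.hausdorffMeasure_apply, ENNReal.iSup_eq_zero] at hzero
      have h1 := (ENNReal.iSup_eq_zero.1 (hzero η) hη0).trans_lt hη0
      simp only [iInf_lt_iff] at h1
      obtain ⟨t, h2, h3, h4⟩ := h1
      exact ⟨t, h2, h3, h4⟩
    -- Rounding errors for the pieces of the cover, with total below η.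
    obtain ⟨δ, hδ0, hδsum⟩ := ENNReal.exists_pos_sum_of_countable hη0.ne' ℕ
    have hB : ∀ n, ∃ B : Fin N → Set X, f ⁻¹' (t n) ⊆ ⋃ j, B j ∧ (∀ j, ediam (B j) ≤ η) ∧
        ∀ j, ediam (B j) ^ (d : ℝ) ≤
          c₁ * (⨆ _ : (t n).Nonempty, ediam (t n) ^ (d : ℝ)) + δ n := by
      intro n
      rcases (t n).eq_empty_or_nonempty with hn | hn
      · refine ⟨fun _ => ∅, by simp [hn], by simp, fun j => ?_⟩
        rw [ediam_empty, ENNReal.zero_rpow_of_pos hd0]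
        exact zero_le
      · obtain ⟨k, hk1, hk2, hk3⟩ := ENNReal.exists_pow_near_rpow_le hβ0 hβ1 hd0 (hdiam n)
          (ENNReal.coe_pos.2 (hδ0 n))
        obtain ⟨B, hB1, hB2⟩ := h (t n) k hn hk2
        refine ⟨B, hB1, fun j => (hB2 j).trans ?_, fun j => ?_⟩
        · exact ENNReal.coe_le_coe.2 (pow_le_pow_of_le_one zero_le hβ1.le hk1)
        · rw [iSup_pos hn]
          exact (ENNReal.rpow_le_rpow (hB2 j) hd0.le).trans hk3
    choose B hB1 hB2 hB3 using hB
    refine ⟨fun i => B i.1 i.2, fun x hx => ?_, fun i => hB2 _ _, ?_⟩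
    · obtain ⟨n, hn⟩ := Set.mem_iUnion.1 (hcov (Set.mem_image_of_mem f hx))
      obtain ⟨j, hj⟩ := Set.mem_iUnion.1 (hB1 n hn)
      exact Set.mem_iUnion.2 ⟨(n, j), hj⟩
    · calc ∑' i : ℕ × Fin N, ediam (B i.1 i.2) ^ (d : ℝ)
          ≤ ∑' i : ℕ × Fin N,
            (c₁ * (⨆ _ : (t i.1).Nonempty, ediam (t i.1) ^ (d : ℝ)) + δ i.1) :=
            ENNReal.tsum_le_tsum fun i => hB3 _ _
        _ = ∑' n, (N : ℝ≥0∞) * (c₁ * (⨆ _ : (t n).Nonempty, ediam (t n) ^ (d : ℝ)) + δ n) := by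
            rw [ENNReal.tsum_prod']
            simp [tsum_fintype, mul_add]
        _ = N * (c₁ * ∑' n, (⨆ _ : (t n).Nonempty, ediam (t n) ^ (d : ℝ)) + ∑' n, (δ n : ℝ≥0∞)) := by
            rw [ENNReal.tsum_mul_left, ENNReal.tsum_add, ENNReal.tsum_mul_left]
        _ ≤ N * (c₁ * η + η) := by gcongr
        _ = N * (c₁ + 1) * η := by ring
  choose t ht1 ht2 ht3 using step
  have hβlim : Tendsto (fun K : ℕ => ((β ^ K : ℝ≥0) : ℝ≥0∞)) atTop (𝓝 0) :=
    ENNReal.tendsto_coe.2 (NNReal.tendsto_pow_atTop_nhds_zero_of_lt_one hβ1)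
  have hle : μH[d] S ≤ 0 := by
    refine (Measure.hausdorffMeasure_le_liminf_tsum (d : ℝ) S _ hβlim t
      (Eventually.of_forall ht2) (Eventually.of_forall ht1)).trans ?_
    have hlim : Tendsto (fun K : ℕ => N * (c₁ + 1) * ((β ^ K : ℝ≥0) : ℝ≥0∞)) atTop (𝓝 0) := by
      have := ENNReal.Tendsto.const_mul hβlim (a := N * (c₁ + 1)) (Or.inr (by finiteness))
      simpa using this
    rw [← hlim.liminf_eq]
    exact liminf_le_liminf (Eventually.of_forall ht3)
  exact dimH_le_of_hausdorffMeasure_ne_top (by simp [le_zero_iff.1 hle])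

end HausdorffDimension

/-! ### Invariance of dimension under the digit map -/

section IotaDimension

open Metric

/-- The integer with base-`b` digits `a 0, …, a (n - 1)`, the digit `a 0` being the leading one. -/
def leadingDigits {b : ℕ} (a : ℕ → Fin b) : ℕ → ℕ
  | 0 => 0
  | n + 1 => b * leadingDigits a n + a n

theorem leadingDigits_injective {b : ℕ} {x y : ℕ → Fin b} {n : ℕ}
    (h : leadingDigits x n = leadingDigits y n) : ∀ i < n, x i = y i := by
  induction n with
  | zero => simp
  | succ n ih =>
    simp only [leadingDigits] at h
    have hb : 0 < b := Fin.pos (x 0)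
    have hmod := congrArg (· % b) h
    have hdiv := congrArg (· / b) h
    simp only [Nat.mul_add_mod, Nat.mod_eq_of_lt (Fin.is_lt _)] at hmod
    simp only [Nat.mul_add_div hb, Nat.div_eq_of_lt (Fin.is_lt _), add_zero] at hdiv
    intro i hi
    rcases Nat.lt_succ_iff_lt_or_eq.1 hi with hi | rfl
    · exact ih hdiv i hi
    · exact Fin.ext hmod

theorem pow_mul_ofDigits {b : ℕ} (a : ℕ → Fin b) (n : ℕ) :
    (b : ℝ) ^ n * Real.ofDigits a = leadingDigits a n + Real.ofDigits fun i => a (i + n) := by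
  have hb : (b : ℝ) ≠ 0 := by exact_mod_cast (Fin.pos (a 0)).ne'
  have h : (b : ℝ) ^ n * ∑ i ∈ Finset.range n, Real.ofDigitsTerm a i = leadingDigits a n := by
    induction n with
    | zero => simp [leadingDigits]
    | succ n ih =>
      rw [Finset.sum_range_succ, mul_add, pow_succ', mul_assoc, ih, ← pow_succ',
        Real.ofDigitsTerm, leadingDigits, mul_left_comm, mul_inv_cancel₀ (pow_ne_zero _ hb)]
      push_cast
      ring
  rw [Real.ofDigits_eq_sum_add_ofDigits a n, mul_add, h, mul_inv_cancel_left₀ (pow_ne_zero _ hb)]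

/-- After scaling by bⁿ the two reals differ by at most 1, and dropping their tails in [0, 1] costs
at most 1 more. -/
theorem abs_leadingDigits_sub_le {b : ℕ} {x y : ℕ → Fin b} {n : ℕ}
    (h : |Real.ofDigits x - Real.ofDigits y| ≤ ((b : ℝ) ^ n)⁻¹) :
    |(leadingDigits x n : ℤ) - leadingDigits y n| ≤ 2 := by
  have hb : (0 : ℝ) < (b : ℝ) ^ n := pow_pos (by exact_mod_cast Fin.pos (x 0)) n
  have hx := pow_mul_ofDigits x n
  have hy := pow_mul_ofDigits y n
  have hx0 := Real.ofDigits_nonneg fun i => x (i + n)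
  have hx1 := Real.ofDigits_le_one fun i => x (i + n)
  have hy0 := Real.ofDigits_nonneg fun i => y (i + n)
  have hy1 := Real.ofDigits_le_one fun i => y (i + n)
  have h1 : |(b : ℝ) ^ n * Real.ofDigits x - (b : ℝ) ^ n * Real.ofDigits y| ≤ 1 := by
    rw [← mul_sub, abs_mul, abs_of_pos hb]
    calc _ ≤ (b : ℝ) ^ n * ((b : ℝ) ^ n)⁻¹ := by gcongr
      _ = 1 := mul_inv_cancel₀ hb.ne'
  rw [abs_le] at h1
  have : |(leadingDigits x n : ℝ) - leadingDigits y n| ≤ 2 := by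
    rw [abs_le]
    constructor <;> linarith [h1.1, h1.2]
  exact_mod_cast this

variable {p : ℕ} [hp : Fact p.Prime]

theorem iotaP_preimage_cover (U : Set ℝ) (k : ℕ)
    (hU : ediam U ≤ ((((p : ℝ≥0)⁻¹) ^ k : ℝ≥0) : ℝ≥0∞)) :
    ∃ B : Fin 5 → Set ℤ_[p], iotaP p ⁻¹' U ⊆ ⋃ j, B j ∧
      ∀ j, ediam (B j) ≤ ((((p : ℝ≥0)⁻¹) ^ k : ℝ≥0) : ℝ≥0∞) := by
  rcases (iotaP p ⁻¹' U).eq_empty_or_nonempty with h0 | ⟨x₀, hx₀⟩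
  · exact ⟨fun _ => ∅, by simp [h0], by simp⟩
  -- The five sets are the cylinders whose leading integer differs from that of x₀ by -2, …, 2.
  refine ⟨fun j => {x | (leadingDigits (padicDigits x) k : ℤ) =
    leadingDigits (padicDigits x₀) k + ((j : ℕ) : ℤ) - 2}, fun x hx => ?_, fun j => ?_⟩
  · have h1 : edist (iotaP p x) (iotaP p x₀) ≤ ((((p : ℝ≥0)⁻¹) ^ k : ℝ≥0) : ℝ≥0∞) :=
      (edist_le_ediam_of_mem (s := U) hx hx₀).trans hU
    rw [edist_nndist, ENNReal.coe_le_coe, ← NNReal.coe_le_coe, coe_nndist, Real.dist_eq,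
      iotaP_eq_ofDigits, iotaP_eq_ofDigits] at h1
    have h2 := abs_leadingDigits_sub_le (n := k) (h1.trans (by simp))
    rw [abs_le] at h2
    obtain ⟨j, hj⟩ := Int.eq_ofNat_of_zero_le (a := (leadingDigits (padicDigits x) k : ℤ) -
      leadingDigits (padicDigits x₀) k + 2) (by omega)
    refine Set.mem_iUnion.2 ⟨⟨j, by omega⟩, ?_⟩
    simp only [Set.mem_ofPred_eq]
    omega
  · refine ediam_le fun x hx y hy => ?_
    have h1 : leadingDigits (padicDigits x) k = leadingDigits (padicDigits y) k := by
      simp only [Set.mem_ofPred_eq] at hx hy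
      omega
    have h2 := (norm_sub_le_iff_padicDigits x y k).2 (leadingDigits_injective h1)
    rw [edist_nndist, ENNReal.coe_le_coe, ← NNReal.coe_le_coe, coe_nndist, dist_eq_norm]
    simpa using h2

theorem dimH_image_iotaP (S : Set ℤ_[p]) : dimH S = dimH (iotaP p '' S) := by
  have hp1 : (1 : ℝ≥0) < p := by exact_mod_cast hp.out.one_lt
  refine le_antisymm ?_ (lipschitzWith_iotaP.dimH_image_le S)
  exact dimH_le_dimH_image_of_preimage_cover (iotaP p) (inv_pos.2 (zero_lt_one.trans hp1))
    (inv_lt_one_of_one_lt₀ hp1) 5 (fun U k _ hU => iotaP_preimage_cover U k hU) S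

end IotaDimension

/-! ### Finite paths, powers of the adjacency matrix, concatenation of loops -/

section PathCounting

variable {V E A : Type*}

namespace LabeledGraph

/-- `e` is an infinite walk in `G` that starts at `v`. -/
def IsWalk (G : LabeledGraph V E A) (v : V) (e : ℕ → E) : Prop :=
  G.src (e 0) = v ∧ ∀ k, G.tgt (e k) = G.src (e (k + 1))

theorem IsWalk.tail {G : LabeledGraph V E A} {v : V} {e : ℕ → E} (h : G.IsWalk v e) :
    G.IsWalk (G.tgt (e 0)) fun k => e (k + 1) :=
  ⟨(h.2 0).symm, fun k => h.2 (k + 1)⟩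

/-- Prepend an element to a sequence. -/
def seqCons {B : Type*} (b : B) (s : ℕ → B) : ℕ → B
  | 0 => b
  | k + 1 => s k

theorem IsWalk.cons {G : LabeledGraph V E A} {e₀ : E} {e : ℕ → E} (h : G.IsWalk (G.tgt e₀) e) :
    G.IsWalk (G.src e₀) (seqCons e₀ e) := by
  refine ⟨rfl, fun k => ?_⟩
  cases k with
  | zero => exact h.1.symm
  | succ k => exact h.2 k

/-- A sequence of closed paths of length `m + 1` at `w` concatenates to an infinite walk. -/
theorem isWalk_concat (G : LabeledGraph V E A) {m : ℕ} {w : V} {B : Type*} (g : B → ℕ → E)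
    (h0 : ∀ b, G.src (g b 0) = w) (hstep : ∀ b, ∀ k < m, G.tgt (g b k) = G.src (g b (k + 1)))
    (hlast : ∀ b, G.tgt (g b m) = w) (a : ℕ → B) :
    G.IsWalk w fun k => g (a (k / (m + 1))) (k % (m + 1)) := by
  refine ⟨by simp [h0], fun k => ?_⟩
  beta_reduce
  rcases Nat.lt_or_ge (k % (m + 1)) m with hk | hk
  · have hmod : (k + 1) % (m + 1) = k % (m + 1) + 1 := by
      rw [Nat.add_mod, Nat.mod_eq_of_lt (a := 1) (by omega), Nat.mod_eq_of_lt (by omega)]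
    have hdiv : (k + 1) / (m + 1) = k / (m + 1) := by
      rw [Nat.succ_div_of_not_dvd]
      rw [Nat.dvd_iff_mod_eq_zero]
      omega
    rw [hmod, hdiv, hstep _ _ hk]
  · have hkm : k % (m + 1) = m := by
      have := Nat.mod_lt k (show 0 < m + 1 by omega)
      omega
    have hdvd : m + 1 ∣ k + 1 := by
      refine ⟨k / (m + 1) + 1, ?_⟩
      have := Nat.div_add_mod k (m + 1)
      rw [mul_add]
      omega
    rw [hkm, hlast, Nat.mod_eq_zero_of_dvd hdvd, h0]

open Classical in
/-- The finite paths of length `m` from `i` to `j`, as lists of edges. -/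
noncomputable def paths [Fintype E] (G : LabeledGraph V E A) : ℕ → V → V → Finset (List E)
  | 0, i, j => if i = j then {[]} else ∅
  | m + 1, i, j => (Finset.univ.filter fun e => G.src e = i).biUnion fun e =>
      (paths G m (G.tgt e) j).image (List.cons e)

variable [Fintype E] (G : LabeledGraph V E A)

theorem mem_paths_zero {i j : V} {l : List E} : l ∈ G.paths 0 i j ↔ i = j ∧ l = [] := by
  classical
  rw [paths]
  split_ifs with h <;> simp [h]

theorem mem_paths_succ {m : ℕ} {i j : V} {l : List E} :
    l ∈ G.paths (m + 1) i j ↔ ∃ e, G.src e = i ∧ ∃ l' ∈ G.paths m (G.tgt e) j, e :: l' = l := by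
  simp [paths]

theorem card_paths [Fintype V] [DecidableEq V] (m : ℕ) (i j : V) :
    (G.paths m i j).card = (G.adjacency ^ m) i j := by
  classical
  induction m generalizing i with
  | zero =>
    rw [paths, pow_zero, Matrix.one_apply]
    split_ifs <;> simp
  | succ m ih =>
    rw [paths, Finset.card_biUnion]
    · simp only [Finset.card_image_of_injective _ (List.cons_injective), ih]
      rw [pow_succ', Matrix.mul_apply]
      -- Grouping the first edges by their target turns the sum over edges into a matrix product.
      refine (Finset.sum_fiberwise _ G.tgt _).symm.trans (Finset.sum_congr rfl fun k _ => ?_)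
      rw [Finset.sum_congr rfl (g := fun _ => (G.adjacency ^ m) k j)
        fun e he => by rw [(Finset.mem_filter.1 he).2], Finset.sum_const, smul_eq_mul,
        Finset.filter_filter, adjacency, Matrix.of_apply, Nat.card_eq_fintype_card,
        Fintype.card_subtype]
      congr
    · intro e _ e' _ hne
      rw [Function.onFun, Finset.disjoint_left]
      intro l hl hl'
      obtain ⟨_, _, rfl⟩ := Finset.mem_image.1 hl
      obtain ⟨_, _, h⟩ := Finset.mem_image.1 hl'
      exact hne (List.cons.inj h).1.symm

theorem exists_mem_paths_of_isWalk {v : V} {e : ℕ → E} (h : G.IsWalk v e) (m : ℕ) :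
    ∃ j, (List.range m).map e ∈ G.paths m v j := by
  induction m generalizing v e with
  | zero => exact ⟨v, by simp [mem_paths_zero]⟩
  | succ m ih =>
    obtain ⟨j, hj⟩ := ih h.tail
    refine ⟨j, G.mem_paths_succ.2 ⟨e 0, h.1, _, hj, ?_⟩⟩
    rw [List.range_succ_eq_map, List.map_cons, List.map_map]
    rfl

variable {G} in
theorem RightResolving.eq_of_mem_paths (hG : G.RightResolving) {m : ℕ} {i j j' : V}
    {l l' : List E} (hl : l ∈ G.paths m i j) (hl' : l' ∈ G.paths m i j')
    (h : l.map G.label = l'.map G.label) : l = l' := by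
  induction m generalizing i l l' with
  | zero => rw [(G.mem_paths_zero.1 hl).2, (G.mem_paths_zero.1 hl').2]
  | succ m ih =>
    obtain ⟨e, he, t, ht, rfl⟩ := G.mem_paths_succ.1 hl
    obtain ⟨e', he', t', ht', rfl⟩ := G.mem_paths_succ.1 hl'
    rw [List.map_cons, List.map_cons, List.cons.injEq] at h
    obtain rfl := hG e e' (he.trans he'.symm) h.1
    rw [ih ht ht' h.2]

theorem exists_seq_of_mem_paths {m : ℕ} {i j : V} {l : List E} (hl : l ∈ G.paths (m + 1) i j) :
    ∃ g : ℕ → E, (List.range (m + 1)).map g = l ∧ G.src (g 0) = i ∧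
      (∀ k < m, G.tgt (g k) = G.src (g (k + 1))) ∧ G.tgt (g m) = j := by
  induction m generalizing i l with
  | zero =>
    obtain ⟨e, he, t, ht, rfl⟩ := G.mem_paths_succ.1 hl
    obtain ⟨h, rfl⟩ := G.mem_paths_zero.1 ht
    exact ⟨fun _ => e, rfl, he, by simp, h⟩
  | succ m ih =>
    obtain ⟨e, he, t, ht, rfl⟩ := G.mem_paths_succ.1 hl
    obtain ⟨g, hg, h0, hstep, hlast⟩ := ih ht
    refine ⟨seqCons e g, ?_, he, fun k hk => ?_, hlast⟩
    · rw [List.range_succ_eq_map, List.map_cons, List.map_map, ← hg]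
      rfl
    · cases k with
      | zero => exact h0.symm
      | succ k => exact hstep k (by omega)

end LabeledGraph

end PathCounting

/-! ### The dimension of a path set fractal -/

section PathSetDimension

open MeasureTheory Metric

variable {p : ℕ} [hp : Fact p.Prime]

/-- The `p`-adic path set fractal presented by `(f, G, v)`. -/
def padicPathSet (p : ℕ) [Fact p.Prime] {V E A : Type*} (f : A → Fin p) (G : LabeledGraph V E A)
    (v : V) : Set ℤ_[p] :=
  (fun s : ℕ → A => padicOfDigits p (fun k => f (s k))) '' G.pathSet v

variable {V E A : Type*} {f : A → Fin p} {G : LabeledGraph V E A}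

theorem mem_padicPathSet {v : V} {x : ℤ_[p]} :
    x ∈ padicPathSet p f G v ↔
      ∃ e, G.IsWalk v e ∧ padicOfDigits p (fun k => f (G.label (e k))) = x := by
  constructor
  · rintro ⟨s, ⟨e, h0, hs, hl⟩, rfl⟩
    exact ⟨e, ⟨h0, hs⟩, by simp only [hl]⟩
  · rintro ⟨e, ⟨h0, hs⟩, rfl⟩
    exact ⟨fun k => G.label (e k), ⟨e, h0, hs, fun _ => rfl⟩, rfl⟩

/-- Prepending the edge acts on the fractal as x ↦ digit + p x, which multiplies distances by
exactly 1/p and so loses no dimension. -/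
theorem dimH_padicPathSet_tgt_le (e₀ : E) :
    dimH (padicPathSet p f G (G.tgt e₀)) ≤ dimH (padicPathSet p f G (G.src e₀)) := by
  let T : ℤ_[p] → ℤ_[p] := fun x => ((f (G.label e₀) : ℕ) : ℤ_[p]) + (p : ℤ_[p]) * x
  have hT : AntilipschitzWith (p : ℝ≥0) T := by
    refine AntilipschitzWith.of_le_mul_dist fun x y => ?_
    have hp0 : (p : ℝ) ≠ 0 := by exact_mod_cast hp.out.ne_zero
    rw [dist_add_left, dist_eq_norm, dist_eq_norm, ← mul_sub, norm_mul, PadicInt.norm_p,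
      NNReal.coe_natCast, mul_inv_cancel_left₀ hp0]
  refine (hT.le_dimH_image _).trans (dimH_mono ?_)
  rintro _ ⟨x, hx, rfl⟩
  obtain ⟨e, he, rfl⟩ := mem_padicPathSet.1 hx
  refine mem_padicPathSet.2 ⟨_, he.cons, ?_⟩
  rw [padicOfDigits_eq_sum_add _ 1]
  simp [T, LabeledGraph.seqCons]

theorem dimH_padicPathSet_le_of_reachable {v w : V}
    (h : Relation.ReflTransGen (fun a b => ∃ e : E, G.src e = a ∧ G.tgt e = b) v w) :
    dimH (padicPathSet p f G w) ≤ dimH (padicPathSet p f G v) := by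
  induction h with
  | refl => exact le_rfl
  | tail _ h ih =>
    obtain ⟨e, rfl, rfl⟩ := h
    exact (dimH_padicPathSet_tgt_le e).trans ih

/-- Reading the symbols as base-L digits maps the range onto [0, 1]. Agreement to p⁻ᵐⁿ forces n
common symbols, so this map is Hölder with exponent s = log_p L / m, and 1 ≤ dim / s. -/
theorem le_dimH_range_of_separated {L m : ℕ} (hL : 1 < L) (hm : 1 ≤ m)
    (Φ : (ℕ → Fin L) → ℤ_[p])
    (h : ∀ a b n, ‖Φ a - Φ b‖ ≤ ((p : ℝ) ^ (m * n))⁻¹ → ∀ q < n, a q = b q) :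
    ENNReal.ofReal (Real.logb p L / m) ≤ dimH (Set.range Φ) := by
  have hp1 : (1 : ℝ) < p := by exact_mod_cast hp.out.one_lt
  have hp0 : (0 : ℝ) < p := zero_lt_one.trans hp1
  have hL1 : (1 : ℝ) < L := by exact_mod_cast hL
  have hL0 : (0 : ℝ) < L := zero_lt_one.trans hL1
  have hm0 : (0 : ℝ) < m := by exact_mod_cast hm
  have : Nonempty (ℕ → Fin L) := ⟨fun _ => ⟨0, by omega⟩⟩
  have hinj : Function.Injective Φ := fun a b hab => funext fun q =>
    h a b (q + 1) (by rw [hab, sub_self, norm_zero]; positivity) q q.lt_succ_self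
  set s : ℝ := Real.logb p L / m with hs
  have hs0 : 0 < s := div_pos (Real.logb_pos hp1 hL1) hm0
  have hps : ∀ n : ℕ, (((p : ℝ) ^ (m * n))⁻¹) ^ s = ((L : ℝ) ^ n)⁻¹ := by
    intro n
    rw [Real.inv_rpow (by positivity), ← Real.rpow_natCast, ← Real.rpow_mul hp0.le]
    have : ((m * n : ℕ) : ℝ) * s = Real.logb p L * n := by
      rw [hs]; push_cast; field_simp
    rw [this, Real.rpow_mul hp0.le, Real.rpow_logb hp0 hp1.ne' hL0, Real.rpow_natCast]
  let F : ℤ_[p] → ℝ := fun x => Real.ofDigits (Function.invFun Φ x)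
  have hF : ∀ a, F (Φ a) = Real.ofDigits a := fun a => by
    simp only [F, Function.leftInverse_invFun hinj a]
  have hhold : HolderOnWith (L : ℝ≥0) s.toNNReal F (Set.range Φ) := by
    rintro _ ⟨a, rfl⟩ _ ⟨b, rfl⟩
    rw [hF, hF, edist_nndist, edist_nndist, ← ENNReal.coe_rpow_of_nonneg _ (by positivity),
      ← ENNReal.coe_mul, ENNReal.coe_le_coe, ← NNReal.coe_le_coe]
    push_cast
    rw [Real.coe_toNNReal _ hs0.le, Real.dist_eq, dist_eq_norm]
    rcases eq_or_ne a b with rfl | hab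
    · simp [Real.zero_rpow hs0.ne']
    have hv := PadicInt.norm_eq_zpow_neg_valuation (sub_ne_zero.2 (hinj.ne hab))
    rw [zpow_neg, zpow_natCast] at hv
    set v := (Φ a - Φ b).valuation
    -- The number of complete blocks of length m among the first v digits. The incomplete block that
    -- may remain accounts for the Hölder constant L.
    set n := v / m with hn
    have h1 : m * n ≤ v := Nat.mul_div_le v m
    have h2 : v ≤ m * (n + 1) := (Nat.lt_mul_div_succ v hm).le
    have h3 : |Real.ofDigits a - Real.ofDigits b| ≤ ((L : ℝ) ^ n)⁻¹ := by
      refine Real.abs_ofDigits_sub_ofDigits_le (h a b n ?_)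
      rw [hv]
      gcongr
      exact hp1.le
    calc _ ≤ ((L : ℝ) ^ n)⁻¹ := h3
      _ = L * ((L : ℝ) ^ (n + 1))⁻¹ := by rw [pow_succ]; field_simp
      _ = L * (((p : ℝ) ^ (m * (n + 1)))⁻¹) ^ s := by rw [hps]
      _ ≤ L * ‖Φ a - Φ b‖ ^ s := by
        rw [hv]
        gcongr
        exact hp1.le
  have hsub : Set.Icc (0 : ℝ) 1 ⊆ F '' Set.range Φ := by
    intro y hy
    obtain ⟨a, -, rfl⟩ := Real.ofDigits_SurjOn hL hy
    exact ⟨Φ a, ⟨a, rfl⟩, hF a⟩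
  have hone : dimH (Set.Icc (0 : ℝ) 1) = 1 := by
    rw [Real.dimH_of_nonempty_interior (by simp)]
    simp
  have hfin := (dimH_mono hsub).trans (hhold.dimH_image_le (Real.toNNReal_pos.2 hs0))
  rw [hone, ENNReal.le_div_iff_mul_le (by simp [hs0]) (by simp), one_mul] at hfin
  exact hfin

variable [Fintype V] [DecidableEq V] [Finite E]

theorem le_dimH_padicPathSet_of_loops (hf : Function.Injective f) (hG : G.RightResolving)
    {m : ℕ} (hm : 1 ≤ m) {w : V} {r : ℝ} (hr : 1 < r) (h : r ^ m ≤ ((G.adjacency ^ m) w w : ℝ)) :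
    ENNReal.ofReal (Real.logb p r) ≤ dimH (padicPathSet p f G w) := by
  have hp1 : (1 : ℝ) < p := by exact_mod_cast hp.out.one_lt
  have := Fintype.ofFinite E
  obtain ⟨m, rfl⟩ := Nat.exists_eq_add_of_le' hm
  set L := (G.adjacency ^ (m + 1)) w w with hLdef
  have hL : 1 < L := by
    have := (one_lt_pow₀ hr m.succ_ne_zero).trans_le h
    exact_mod_cast this
  let φ : Fin L ≃ G.paths (m + 1) w w :=
    (finCongr (G.card_paths (m + 1) w w).symm).trans (G.paths (m + 1) w w).equivFin.symm
  have hg := fun b : Fin L => G.exists_seq_of_mem_paths (φ b).2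
  choose g hgl hg0 hgs hglast using hg
  have hwalk := G.isWalk_concat g hg0 hgs hglast
  let Φ : (ℕ → Fin L) → ℤ_[p] := fun a =>
    padicOfDigits p fun k => f (G.label (g (a (k / (m + 1))) (k % (m + 1))))
  have hsep : ∀ a b n, ‖Φ a - Φ b‖ ≤ ((p : ℝ) ^ ((m + 1) * n))⁻¹ → ∀ q < n, a q = b q := by
    intro a b n hab q hq
    rw [norm_padicOfDigits_sub_le_iff] at hab
    refine φ.injective (Subtype.ext (hG.eq_of_mem_paths (φ (a q)).2 (φ (b q)).2 ?_))
    rw [← hgl, ← hgl, List.map_map, List.map_map]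
    refine List.map_congr_left fun k hk => ?_
    have hk : k < m + 1 := List.mem_range.1 hk
    -- Position (m + 1) q + k is the k-th edge of the q-th loop.
    have := hf (hab ((m + 1) * q + k) (by nlinarith))
    rwa [Nat.mul_add_div m.succ_pos, Nat.div_eq_of_lt hk, add_zero, Nat.mul_add_mod,
      Nat.mod_eq_of_lt hk] at this
  have hrange : Set.range Φ ⊆ padicPathSet p f G w := by
    rintro _ ⟨a, rfl⟩
    exact mem_padicPathSet.2 ⟨_, hwalk a, rfl⟩
  refine le_trans ?_ ((le_dimH_range_of_separated hL hm Φ hsep).trans (dimH_mono hrange))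
  refine ENNReal.ofReal_le_ofReal ?_
  rw [le_div_iff₀ (by positivity), mul_comm, ← Real.logb_pow]
  exact Real.logb_le_logb_of_le hp1 (by positivity) h

/-- The d-th powers of the diameters in the cover by cylinders of level m sum to at most 1 for all
large m, so the d-dimensional measure is finite. -/
theorem dimH_padicPathSet_le [Nonempty V] (v : V) {d : ℝ≥0}
    (hd : G.adjSpectralRadius < (p : ℝ) ^ (d : ℝ)) : dimH (padicPathSet p f G v) ≤ d := by
  have hp1 : (1 : ℝ) < p := by exact_mod_cast hp.out.one_lt
  have hp0 : (0 : ℝ) < p := zero_lt_one.trans hp1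
  have := Fintype.ofFinite E
  classical
  let P : ℕ → Finset (List E) := fun m => Finset.univ.biUnion fun j => G.paths m v j
  let t : ∀ m : ℕ, P m → Set ℤ_[p] := fun m l =>
    {x | ∃ e, G.IsWalk v e ∧ (List.range m).map e = l ∧
      padicOfDigits p (fun k => f (G.label (e k))) = x}
  let β : ℝ≥0 := (p : ℝ≥0)⁻¹
  have hβ1 : β < 1 := inv_lt_one_of_one_lt₀ (by exact_mod_cast hp1)
  have hdiam : ∀ m (l : P m), ediam (t m l) ≤ ((β ^ m : ℝ≥0) : ℝ≥0∞) := by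
    intro m l
    refine ediam_le ?_
    rintro _ ⟨e, -, he, rfl⟩ _ ⟨e', -, he', rfl⟩
    have hee : ∀ k < m, e k = e' k := by
      have := List.map_inj_left.1 (he.trans he'.symm)
      simpa using this
    have := (norm_padicOfDigits_sub_le_iff (fun k => f (G.label (e k)))
      (fun k => f (G.label (e' k))) m).2 fun k hk => by rw [hee k hk]
    rw [edist_nndist, ENNReal.coe_le_coe, ← NNReal.coe_le_coe, coe_nndist, dist_eq_norm]
    simpa [β] using this
  have hcov : ∀ m, padicPathSet p f G v ⊆ ⋃ l, t m l := by
    intro m x hx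
    obtain ⟨e, he, rfl⟩ := mem_padicPathSet.1 hx
    obtain ⟨j, hj⟩ := G.exists_mem_paths_of_isWalk he m
    exact Set.mem_iUnion.2
      ⟨⟨_, Finset.mem_biUnion.2 ⟨j, Finset.mem_univ _, hj⟩⟩, e, he, rfl, rfl⟩
  have hsum : ∀ᶠ m in atTop, ∑ l, ediam (t m l) ^ (d : ℝ) ≤ 1 := by
    filter_upwards [G.adjacency.eventually_sum_pow_le hd] with m hm
    have hcard : ((P m).card : ℝ) ≤ ((p : ℝ) ^ (d : ℝ)) ^ m := by
      refine le_trans ?_ (hm v)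
      rw [Nat.cast_le]
      refine Finset.card_biUnion_le.trans (le_of_eq ?_)
      exact Finset.sum_congr rfl fun j _ => G.card_paths m v j
    have hβm : (((β ^ m : ℝ≥0) : ℝ≥0∞)) ^ (d : ℝ) =
        ENNReal.ofReal ((((p : ℝ) ^ (d : ℝ)) ^ m)⁻¹) := by
      rw [← ENNReal.coe_rpow_of_nonneg _ d.coe_nonneg, ← ENNReal.ofReal_coe_nnreal]
      congr 1
      push_cast
      rw [NNReal.coe_inv, NNReal.coe_natCast, inv_pow, Real.inv_rpow (by positivity),
        ← Real.rpow_natCast, ← Real.rpow_natCast, ← Real.rpow_mul hp0.le, ← Real.rpow_mul hp0.le,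
        mul_comm]
    calc ∑ l, ediam (t m l) ^ (d : ℝ)
        ≤ ∑ _l : P m, ENNReal.ofReal ((((p : ℝ) ^ (d : ℝ)) ^ m)⁻¹) :=
          Finset.sum_le_sum fun l _ =>
            (ENNReal.rpow_le_rpow (hdiam m l) d.coe_nonneg).trans hβm.le
      _ = ENNReal.ofReal ((P m).card * (((p : ℝ) ^ (d : ℝ)) ^ m)⁻¹) := by
          rw [Finset.sum_const, nsmul_eq_mul, ENNReal.ofReal_mul (by positivity)]
          simp
      _ ≤ 1 := by
          rw [← ENNReal.ofReal_one]
          refine ENNReal.ofReal_le_ofReal ?_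
          rw [← div_eq_mul_inv]
          exact div_le_one_of_le₀ hcard (by positivity)
  have hβlim : Tendsto (fun m : ℕ => ((β ^ m : ℝ≥0) : ℝ≥0∞)) atTop (𝓝 0) :=
    ENNReal.tendsto_coe.2 (NNReal.tendsto_pow_atTop_nhds_zero_of_lt_one hβ1)
  borelize ℤ_[p]
  have hle : μH[d] (padicPathSet p f G v) ≤ 1 := by
    refine (Measure.hausdorffMeasure_le_liminf_sum (d : ℝ) _ _ hβlim t
      (Eventually.of_forall hdiam) (Eventually.of_forall hcov)).trans ?_
    exact liminf_le_of_le (by isBoundedDefault) fun b hb => by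
      obtain ⟨m, h1, h2⟩ := (hb.and hsum).exists
      exact h1.trans h2
  exact dimH_le_of_hausdorffMeasure_ne_top (ne_top_of_le_ne_top ENNReal.one_ne_top hle)

/-- The prefixes of one infinite walk give every power of the adjacency matrix a nonzero entry. -/
theorem one_le_adjSpectralRadius {v : V} (h : (padicPathSet p f G v).Nonempty) :
    1 ≤ G.adjSpectralRadius := by
  have := Fintype.ofFinite E
  have : Nonempty V := ⟨v⟩
  obtain ⟨x, hx⟩ := h
  obtain ⟨e, he, -⟩ := mem_padicPathSet.1 hx
  refine G.adjacency.one_le_natSpectralRadius (Eventually.of_forall fun m => ?_).frequently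
  obtain ⟨j, hj⟩ := G.exists_mem_paths_of_isWalk he m
  refine ⟨v, j, ?_⟩
  rw [← G.card_paths]
  exact Finset.card_pos.2 ⟨_, hj⟩

theorem dimH_padicPathSet {v : V} (hf : Function.Injective f) (hG : G.RightResolving)
    (hreach : G.ReachableFrom v) (hne : (padicPathSet p f G v).Nonempty) :
    dimH (padicPathSet p f G v) = ENNReal.ofReal (Real.logb p G.adjSpectralRadius) := by
  have hp1 : (1 : ℝ) < p := by exact_mod_cast hp.out.one_lt
  have hp0 : (0 : ℝ) < p := zero_lt_one.trans hp1
  have : Nonempty V := ⟨v⟩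
  have hσ := one_le_adjSpectralRadius hne
  have hσ0 : 0 < G.adjSpectralRadius := zero_lt_one.trans_le hσ
  refine le_antisymm ?_ ?_
  · refine le_of_forall_gt_imp_ge_of_dense fun c hc => ?_
    obtain ⟨d, hd1, hd2⟩ := ENNReal.lt_iff_exists_nnreal_btwn.1 hc
    refine (dimH_padicPathSet_le v ?_).trans hd2.le
    rw [← Real.logb_lt_iff_lt_rpow hp1 hσ0]
    rw [← ENNReal.ofReal_coe_nnreal] at hd1
    exact (ENNReal.ofReal_lt_ofReal_iff'.1 hd1).1
  · refine le_of_forall_lt_imp_le_of_dense fun c hc => ?_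
    obtain ⟨d, hd1, hd2⟩ := ENNReal.lt_iff_exists_nnreal_btwn.1 hc
    refine hd1.le.trans ?_
    rw [← ENNReal.ofReal_coe_nnreal] at hd2
    have hd := (ENNReal.ofReal_lt_ofReal_iff'.1 hd2).1
    rw [Real.lt_logb_iff_rpow_lt hp1 hσ0] at hd
    -- For d = 0 the bound is trivial, while p^d = 1 would not yield at least two loops.
    rcases eq_or_ne d 0 with rfl | hd0
    · simp
    have hr : 1 < (p : ℝ) ^ (d : ℝ) := Real.one_lt_rpow hp1 (by positivity)
    obtain ⟨m, hm, w, hw⟩ := G.adjacency.exists_pow_le_pow_diag (zero_lt_one.trans hr) hd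
    have := (le_dimH_padicPathSet_of_loops (p := p) hf hG hm hr hw).trans
      (dimH_padicPathSet_le_of_reachable (hreach w))
    rwa [Real.logb_rpow hp0 hp1.ne', ENNReal.ofReal_coe_nnreal] at this

end PathSetDimension

/-! ### Uniqueness of invariant vectors; nonoverlapping intervals -/

section Uniqueness

namespace GraphDirectedConstruction

variable {X : Type*} [NormedAddCommGroup X] [InnerProductSpace ℝ X] [FiniteDimensional ℝ X]
  {n : ℕ} {C : GraphDirectedConstruction X n}

/-- A point of K i is reached along m edges from some point of a K j. Following the same edges from
a point of K' j gives a point of K' i within ρᵐ times the diameter of the union of the J i;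
closedness of K' i finishes. -/
theorem IsInvariant.subset_of_ratio_eq {ρ : ℝ} (hρ0 : 0 ≤ ρ) (hρ1 : ρ < 1)
    (ht : ∀ i j, C.graph.Adj i j → C.t i j = ρ) {K K' : Fin n → Set X} (hK : C.IsInvariant K)
    (hK' : C.IsInvariant K') (i : Fin n) : K i ⊆ K' i := by
  have hbdd : Bornology.IsBounded (⋃ i, C.J i) := (isCompact_iUnion C.isCompact_J).isBounded
  set D := Metric.diam (⋃ i, C.J i)
  have key : ∀ (m : ℕ) (i : Fin n), ∀ x ∈ K i, ∃ y ∈ K' i, dist x y ≤ ρ ^ m * D := by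
    intro m
    induction m with
    | zero =>
      intro i x hx
      obtain ⟨y, hy⟩ := hK'.nonempty i
      refine ⟨y, hy, ?_⟩
      rw [pow_zero, one_mul]
      exact Metric.dist_le_diam_of_mem hbdd (Set.mem_iUnion.2 ⟨i, hK.subset i hx⟩)
        (Set.mem_iUnion.2 ⟨i, hK'.subset i hy⟩)
    | succ m ih =>
      intro i x hx
      rw [hK.eq_iUnion i] at hx
      obtain ⟨j, hij, z, hz, rfl⟩ := Set.mem_iUnion₂.1 hx
      obtain ⟨y, hy, hzy⟩ := ih j z hz
      refine ⟨C.T i j y, ?_, ?_⟩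
      · rw [hK'.eq_iUnion i]
        exact Set.mem_iUnion₂.2 ⟨j, hij, y, hy, rfl⟩
      · rw [C.similarity i j hij, ht i j hij, pow_succ', mul_assoc]
        gcongr
  intro x hx
  rw [← (hK'.isCompact i).isClosed.closure_eq, Metric.mem_closure_iff]
  intro ε hε
  have hlim : Tendsto (fun m : ℕ => ρ ^ m * D) atTop (𝓝 0) := by
    simpa using (tendsto_pow_atTop_nhds_zero_of_lt_one hρ0 hρ1).mul_const D
  obtain ⟨m, hm⟩ := (hlim.eventually_lt_const hε).exists
  obtain ⟨y, hy, hxy⟩ := key m i x hx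
  exact ⟨y, hy, hxy.trans_lt hm⟩

theorem IsInvariant.eq_of_ratio_eq {ρ : ℝ} (hρ0 : 0 ≤ ρ) (hρ1 : ρ < 1)
    (ht : ∀ i j, C.graph.Adj i j → C.t i j = ρ) {K K' : Fin n → Set X} (hK : C.IsInvariant K)
    (hK' : C.IsInvariant K') : K = K' :=
  funext fun i => (hK.subset_of_ratio_eq hρ0 hρ1 ht hK' i).antisymm
    (hK'.subset_of_ratio_eq hρ0 hρ1 ht hK i)

end GraphDirectedConstruction

theorem Overlap.mono {X : Type*} [TopologicalSpace X] {S S' T T' : Set X} (hS : S ⊆ S')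
    (hT : T ⊆ T') (h : Overlap S T) : Overlap S' T' :=
  Set.Nonempty.mono (interior_mono (Set.inter_subset_inter hS hT)) h

theorem Overlap.symm {X : Type*} [TopologicalSpace X] {S T : Set X} (h : Overlap S T) :
    Overlap T S := by
  rwa [Overlap, Set.inter_comm]

theorem not_overlap_Icc {a b c d : ℝ} (h : b ≤ c) :
    ¬ Overlap (Set.Icc a b) (Set.Icc c d) := by
  rw [Overlap, Set.Icc_inter_Icc, interior_Icc, Set.nonempty_Ioo, not_lt]
  exact (min_le_left _ _).trans (h.trans (le_max_right _ _))

end Uniqueness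

/-! ### The graph-directed construction attached to a pointed graph -/

section Construction

namespace LabeledGraph

variable {V E A : Type*}

/-- An edge is live if some infinite walk continues it. -/
abbrev LiveEdge (G : LabeledGraph V E A) : Type _ := {e : E // ∃ s, G.IsWalk (G.tgt e) s}

/-- The vertices of the graph-directed construction attached to `G`: the live edges, standing for
the position after traversing that edge, and an initial state `none`. -/
abbrev State (G : LabeledGraph V E A) : Type _ := Option G.LiveEdge

variable (G : LabeledGraph V E A) (v : V)

/-- The vertex of `G` at which a state is located. -/
def stateVertex : G.State → V
  | none => v
  | some e => G.tgt e.1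

/-- There is a transition from `i` to `j` if the edge `j` leaves the vertex of `i`. -/
def StateAdj (i j : G.State) : Prop := ∃ e : G.LiveEdge, j = some e ∧ G.src e.1 = G.stateVertex v i

variable {G v}

theorem IsWalk.stateAdj_head {i : G.State} {e : ℕ → E} (he : G.IsWalk (G.stateVertex v i) e) :
    G.StateAdj v i (some ⟨e 0, _, he.tail⟩) :=
  ⟨_, rfl, he.1⟩

theorem exists_isWalk_stateVertex (hv : ∃ s, G.IsWalk v s) (i : G.State) :
    ∃ s, G.IsWalk (G.stateVertex v i) s := by
  cases i with
  | none => exact hv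
  | some e => exact e.2

variable {p : ℕ}

/-- The digit of the label of a live edge. -/
def stateDigit (f : A → Fin p) : G.State → ℕ
  -- A dummy value: no transition enters `none`.
  | none => 0
  | some e => f (G.label e.1)

theorem stateDigit_ne (f : A → Fin p) (hf : Function.Injective f) (hG : G.RightResolving)
    {i j k : G.State} (hj : G.StateAdj v i j) (hk : G.StateAdj v i k) (hjk : j ≠ k) :
    stateDigit f j ≠ stateDigit f k := by
  obtain ⟨e, rfl, he⟩ := hj
  obtain ⟨e', rfl, he'⟩ := hk
  intro h
  refine hjk (congrArg some (Subtype.ext (hG _ _ (he.trans he'.symm) (hf (Fin.ext h)))))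

theorem StateAdj.stateDigit_lt (f : A → Fin p) {i j : G.State} (h : G.StateAdj v i j) :
    stateDigit f j < p := by
  obtain ⟨e, rfl, -⟩ := h
  exact (f _).2

/-- Every state is connected to the initial one. -/
theorem reachable_state (hreach : G.ReachableFrom v) (j : G.State) :
    (SimpleGraph.fromRel (G.StateAdj v)).Reachable none j := by
  have hadj : ∀ {i j : G.State}, G.StateAdj v i j →
      (SimpleGraph.fromRel (G.StateAdj v)).Reachable i j := by
    intro i j h
    rcases eq_or_ne i j with rfl | hne
    · rfl
    · exact SimpleGraph.Adj.reachable ((SimpleGraph.fromRel_adj _ _ _).2 ⟨hne, Or.inl h⟩)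
  cases j with
  | none => rfl
  | some e =>
    have key : ∀ u, Relation.ReflTransGen (fun a b => ∃ e : E, G.src e = a ∧ G.tgt e = b) v u →
        ∀ e : G.LiveEdge, G.src e.1 = u →
          (SimpleGraph.fromRel (G.StateAdj v)).Reachable none (some e) := by
      intro u hu
      induction hu with
      | refl => exact fun e he => hadj ⟨e, rfl, he⟩
      | tail _ h ih =>
        obtain ⟨e₀, h0, rfl⟩ := h
        intro e he
        obtain ⟨s, hs⟩ := e.2
        -- An edge followed by a live edge is itself live, so the induction along the path stays
        -- among states.
        have hlive : ∃ s, G.IsWalk (G.tgt e₀) s := ⟨_, he ▸ hs.cons⟩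
        exact (ih ⟨e₀, hlive⟩ h0).trans (hadj ⟨e, rfl, he⟩)
    exact key _ (hreach _) e rfl

/-- The real numbers whose base-`p` digits are the labels along an infinite walk from `u`. -/
def walkReals (f : A → Fin p) (G : LabeledGraph V E A) (u : V) : Set ℝ :=
  (fun e : ℕ → E => Real.ofDigits fun k => f (G.label (e k))) '' {e | G.IsWalk u e}

theorem walkReals_subset_Icc (f : A → Fin p) (u : V) : walkReals f G u ⊆ Set.Icc 0 1 := by
  rintro _ ⟨e, -, rfl⟩
  exact ⟨Real.ofDigits_nonneg _, Real.ofDigits_le_one _⟩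

/-- With E finite and discrete, the walks form a closed subset of a compact product, and reading
base-p digits is continuous. -/
theorem isCompact_walkReals [Finite E] (f : A → Fin p) (u : V) : IsCompact (walkReals f G u) := by
  let _ : TopologicalSpace E := ⊥
  have : DiscreteTopology E := ⟨rfl⟩
  have hclosed : IsClosed {e | G.IsWalk u e} := by
    have : {e | G.IsWalk u e} = (fun e : ℕ → E => e 0) ⁻¹' {x | G.src x = u} ∩
        ⋂ k, (fun e : ℕ → E => (e k, e (k + 1))) ⁻¹' {x | G.tgt x.1 = G.src x.2} := by
      ext e
      simp [IsWalk]
    rw [this]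
    refine ((isClosed_discrete _).preimage (continuous_apply 0)).inter (isClosed_iInter fun k => ?_)
    exact (isClosed_discrete _).preimage ((continuous_apply k).prodMk (continuous_apply (k + 1)))
  refine hclosed.isCompact.image (Real.continuous_ofDigits.comp (continuous_pi fun k => ?_))
  exact (continuous_of_discreteTopology (f := fun x : E => f (G.label x))).comp (continuous_apply k)

/-- Splitting off the first edge of a walk, which is live because the rest continues it. This is the
invariance equation before translation. -/
theorem mem_walkReals_stateVertex (f : A → Fin p) (i : G.State) (x : ℝ) :
    x ∈ walkReals f G (G.stateVertex v i) ↔ ∃ j, G.StateAdj v i j ∧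
      ∃ y ∈ walkReals f G (G.stateVertex v j), (stateDigit f j + y) / p = x := by
  have hcons : ∀ a : ℕ → Fin p, Real.ofDigits a =
      ((a 0 : ℕ) + Real.ofDigits fun k => a (k + 1)) / p := fun a => by
    rw [Real.ofDigits_eq_sum_add_ofDigits a 1]
    simp [Real.ofDigitsTerm]
    ring
  constructor
  · rintro ⟨e, he, rfl⟩
    exact ⟨_, IsWalk.stateAdj_head he, _, ⟨_, IsWalk.tail he, rfl⟩,
      (hcons fun k => f (G.label (e k))).symm⟩
  · rintro ⟨_, ⟨e, rfl, he⟩, _, ⟨s, hs, rfl⟩, rfl⟩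
    exact ⟨seqCons e.1 s, he ▸ IsWalk.cons hs,
      hcons fun k => f (G.label (seqCons e.1 s k))⟩

end LabeledGraph

open LabeledGraph

theorem iotaP_image_padicPathSet {V E A : Type*} {p : ℕ} [Fact p.Prime]
    (f : A → Fin p) (G : LabeledGraph V E A) (v : V) :
    iotaP p '' padicPathSet p f G v = walkReals f G v := by
  ext x
  constructor
  · rintro ⟨y, hy, rfl⟩
    obtain ⟨e, he, rfl⟩ := mem_padicPathSet.1 hy
    exact ⟨e, he, (iotaP_padicOfDigits _).symm⟩
  · rintro ⟨e, he, rfl⟩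
    exact ⟨_, mem_padicPathSet.2 ⟨e, he, rfl⟩, iotaP_padicOfDigits _⟩

variable {V E A : Type*} [Finite E] {p : ℕ}

/-- The number of a state. -/
noncomputable def stateEquiv (G : LabeledGraph V E A) : G.State ≃ Fin (Nat.card G.State) :=
  Finite.equivFin _

/-- The left end of the unit interval of a state. -/
noncomputable def stateOffset (G : LabeledGraph V E A) (i : G.State) : ℝ :=
  -- The factor 2 keeps distinct unit intervals disjoint. The subtraction puts `none` at offset 0,
  -- so its sub-object is the image of the path set itself, untranslated.
  2 * (((stateEquiv G i : ℕ) : ℝ) - ((stateEquiv G none : ℕ) : ℝ))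

theorem stateOffset_separated {G : LabeledGraph V E A} {i j : G.State} (h : i ≠ j) :
    stateOffset G i + 1 ≤ stateOffset G j ∨ stateOffset G j + 1 ≤ stateOffset G i := by
  have hne : (stateEquiv G i : ℕ) ≠ stateEquiv G j := fun h' => h ((stateEquiv G).injective
    (Fin.ext h'))
  simp only [stateOffset]
  rcases Nat.lt_or_gt_of_ne hne with hlt | hlt
  · left
    have : ((stateEquiv G i : ℕ) : ℝ) + 1 ≤ (stateEquiv G j : ℕ) := by exact_mod_cast hlt
    linarith
  · right
    have : ((stateEquiv G j : ℕ) : ℝ) + 1 ≤ (stateEquiv G i : ℕ) := by exact_mod_cast hlt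
    linarith

/-- The similarity attached to a transition between states. -/
noncomputable def stateMap (f : A → Fin p) (G : LabeledGraph V E A) (i j : G.State) (x : ℝ) : ℝ :=
  stateOffset G i + (stateDigit f j + (x - stateOffset G j)) / p

theorem stateMap_image_Icc_subset (f : A → Fin p) (G : LabeledGraph V E A) (i j : G.State) :
    stateMap f G i j '' Set.Icc (stateOffset G j) (stateOffset G j + 1) ⊆
      Set.Icc (stateOffset G i + (stateDigit f j : ℝ) / p)
        (stateOffset G i + ((stateDigit f j : ℝ) + 1) / p) := by
  rintro _ ⟨x, ⟨hx0, hx1⟩, rfl⟩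
  constructor <;> rw [stateMap] <;> gcongr <;> linarith

/-- The images lie in the base-p subintervals given by the two digits, which share at most an
endpoint. -/
theorem not_overlap_stateMap_image {f : A → Fin p} {G : LabeledGraph V E A} {i j k : G.State}
    (h : stateDigit f j < stateDigit f k) :
    ¬ Overlap (stateMap f G i j '' Set.Icc (stateOffset G j) (stateOffset G j + 1))
      (stateMap f G i k '' Set.Icc (stateOffset G k) (stateOffset G k + 1)) := by
  intro ho
  refine not_overlap_Icc ?_ (ho.mono (stateMap_image_Icc_subset f G i j)
    (stateMap_image_Icc_subset f G i k))
  have : (stateDigit f j : ℝ) + 1 ≤ stateDigit f k := by exact_mod_cast h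
  gcongr

variable [hp : Fact p.Prime]

/-- The graph-directed construction of the walks in `G` that start at `v`. -/
noncomputable def walkConstruction (f : A → Fin p) (hf : Function.Injective f)
    (G : LabeledGraph V E A) (v : V) (hG : G.RightResolving) (hreach : G.ReachableFrom v)
    (hv : ∃ s, G.IsWalk v s) : GraphDirectedConstruction ℝ (Nat.card G.State) where
  J i := Set.Icc (stateOffset G ((stateEquiv G).symm i)) (stateOffset G ((stateEquiv G).symm i) + 1)
  graph := ⟨fun i j => G.StateAdj v ((stateEquiv G).symm i) ((stateEquiv G).symm j)⟩
  T i j := stateMap f G ((stateEquiv G).symm i) ((stateEquiv G).symm j)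
  t _ _ := 1 / p
  isCompact_J _ := isCompact_Icc
  interior_J _ := by simp
  nonoverlap_J i j hij := by
    rcases stateOffset_separated ((stateEquiv G).symm.injective.ne hij) with h | h
    · exact not_overlap_Icc h
    · exact fun ho => not_overlap_Icc h ho.symm
  exit_edge i := by
    obtain ⟨s, hs⟩ := exists_isWalk_stateVertex hv ((stateEquiv G).symm i)
    exact ⟨stateEquiv G _, by
      simpa only [Equiv.symm_apply_apply] using IsWalk.stateAdj_head hs⟩
  connected := by
    refine SimpleGraph.connected_iff_exists_forall_reachable _ |>.2
      ⟨stateEquiv G none, fun j => ?_⟩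
    have hr := reachable_state hreach ((stateEquiv G).symm j)
    let φ : SimpleGraph.fromRel (G.StateAdj v) →g SimpleGraph.fromRel
        (fun i j => G.StateAdj v ((stateEquiv G).symm i) ((stateEquiv G).symm j)) :=
      ⟨stateEquiv G, fun {a b} h => by
        rw [SimpleGraph.fromRel_adj] at h ⊢
        simpa using h⟩
    simpa [φ] using hr.map φ
  ratio_pos _ _ _ := one_div_pos.2 (by exact_mod_cast hp.out.pos)
  similarity i j _ x y := by
    have hp0 : (0 : ℝ) < p := by exact_mod_cast hp.out.pos
    rw [stateMap, stateMap, dist_add_left, Real.dist_eq, Real.dist_eq, ← sub_div,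
      add_sub_add_left_eq_sub, sub_sub_sub_cancel_right, abs_div, abs_of_pos hp0]
    ring
  nonoverlap_T i j k hij hik hjk := by
    -- Distinct transitions out of one state carry distinct digits, by right-resolution and
    -- injectivity of f.
    rcases Nat.lt_or_gt_of_ne
      (stateDigit_ne f hf hG hij hik ((stateEquiv G).symm.injective.ne hjk)) with h | h
    · exact not_overlap_stateMap_image h
    · exact fun ho => not_overlap_stateMap_image h ho.symm
  image_subset i j hij := by
    have hp0 : (0 : ℝ) < p := by exact_mod_cast hp.out.pos
    have hlt : (stateDigit f ((stateEquiv G).symm j) : ℝ) + 1 ≤ p := by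
      exact_mod_cast StateAdj.stateDigit_lt f hij
    refine (stateMap_image_Icc_subset f G _ _).trans (Set.Icc_subset_Icc ?_ ?_)
    · exact le_add_of_nonneg_right (by positivity)
    · gcongr
      exact (div_le_one hp0).2 hlt
  cycle_contract q _ hq _ _ := by
    rw [Finset.prod_const, Finset.card_range]
    have hp1 : (1 : ℝ) < p := by exact_mod_cast hp.out.one_lt
    exact pow_lt_one₀ (by positivity) ((div_lt_one (zero_lt_one.trans hp1)).2 hp1) hq.ne'

theorem isInvariant_walkConstruction (f : A → Fin p) (hf : Function.Injective f)
    (G : LabeledGraph V E A) (v : V) (hG : G.RightResolving) (hreach : G.ReachableFrom v)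
    (hv : ∃ s, G.IsWalk v s) :
    (walkConstruction f hf G v hG hreach hv).IsInvariant fun i =>
      (fun x => stateOffset G ((stateEquiv G).symm i) + x) ''
        walkReals f G (G.stateVertex v ((stateEquiv G).symm i)) where
  isCompact i := (isCompact_walkReals f _).image (by fun_prop)
  nonempty i := by
    obtain ⟨s, hs⟩ := exists_isWalk_stateVertex hv ((stateEquiv G).symm i)
    exact ⟨_, _, ⟨s, hs, rfl⟩, rfl⟩
  subset i := by
    rintro _ ⟨x, hx, rfl⟩
    obtain ⟨h0, h1⟩ := walkReals_subset_Icc f _ hx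
    exact ⟨by linarith, by linarith⟩
  eq_iUnion i := by
    ext z
    simp only [Set.mem_iUnion, Set.mem_image, exists_prop]
    constructor
    · rintro ⟨x, hx, rfl⟩
      obtain ⟨j, hij, y, hy, rfl⟩ := (mem_walkReals_stateVertex f _ x).1 hx
      obtain ⟨j, rfl⟩ := (stateEquiv G).symm.surjective j
      exact ⟨j, hij, _, ⟨y, hy, rfl⟩, by simp [walkConstruction, stateMap]⟩
    · rintro ⟨j, hij, _, ⟨y, hy, rfl⟩, rfl⟩
      exact ⟨_, (mem_walkReals_stateVertex f _ _).2 ⟨_, hij, y, hy, rfl⟩,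
        by simp [walkConstruction, stateMap]⟩

theorem exists_isSubobject_iotaP_image (f : A → Fin p) (hf : Function.Injective f)
    (G : LabeledGraph V E A) (v : V) (hG : G.RightResolving) (hreach : G.ReachableFrom v)
    (hv : (padicPathSet p f G v).Nonempty) :
    ∃ (n : ℕ) (C : GraphDirectedConstruction ℝ n) (i : Fin n),
      (∀ j k, C.graph.Adj j k → C.t j k = 1 / (p : ℝ)) ∧
        C.IsSubobject i (iotaP p '' padicPathSet p f G v) := by
  have hwalk : ∃ s, G.IsWalk v s := by
    obtain ⟨x, hx⟩ := hv
    obtain ⟨e, he, -⟩ := mem_padicPathSet.1 hx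
    exact ⟨e, he⟩
  have hp1 : (1 : ℝ) < p := by exact_mod_cast hp.out.one_lt
  have hinv := isInvariant_walkConstruction f hf G v hG hreach hwalk
  refine ⟨_, walkConstruction f hf G v hG hreach hwalk, stateEquiv G none, fun _ _ _ => rfl,
    _, hinv, fun K' hK' => ?_, ?_⟩
  · exact hK'.eq_of_ratio_eq (by positivity) ((div_lt_one (zero_lt_one.trans hp1)).2 hp1)
      (fun _ _ _ => rfl) hinv
  · simp [iotaP_image_padicPathSet, stateOffset, stateVertex]

end Construction

theorem theorem3p1 (p : ℕ) [Fact p.Prime] {V E A : Type*} [Fintype V] [DecidableEq V] [Finite E]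
    (f : A → Fin p) (G : LabeledGraph V E A) (v : V) (Y : Set ℤ_[p])
    (hstd : IsStandardPresentation p f G v Y) (hY : Y.Nonempty) :
    -- the map `iotaP` is well described, takes values in `[0, 1]` and is continuous
    (∀ a : ℕ → Fin p,
      iotaP p (padicOfDigits p a) = ∑' k, ((a k : ℕ) : ℝ) / (p : ℝ) ^ (k + 1)) ∧
    (∀ x : ℤ_[p], iotaP p x ∈ Set.Icc (0 : ℝ) 1) ∧
    Continuous (iotaP p) ∧
    -- the image of `Y` is a sub-object of a construction with all ratios `1 / p`
    (∃ (n : ℕ) (C : GraphDirectedConstruction ℝ n) (i : Fin n),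
      (∀ j k, C.graph.Adj j k → C.t j k = 1 / (p : ℝ)) ∧ C.IsSubobject i (iotaP p '' Y)) ∧
    -- Hausdorff dimension is preserved
    (∀ S : Set ℤ_[p], dimH S = dimH (iotaP p '' S)) ∧
    -- the dimension formula; the logarithm is that of a number `≥ 1`
    1 ≤ G.adjSpectralRadius ∧
    dimH Y = dimH (iotaP p '' Y) ∧
    dimH (iotaP p '' Y) = ENNReal.ofReal (Real.logb p G.adjSpectralRadius) := by
  obtain ⟨rfl, hf, hG, hreach⟩ := hstd
  refine ⟨fun a => ?_, fun x => ?_, lipschitzWith_iotaP.continuous,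
    exists_isSubobject_iotaP_image f hf G v hG hreach hY, dimH_image_iotaP,
    one_le_adjSpectralRadius hY, dimH_image_iotaP _, ?_⟩
  · rw [iotaP_padicOfDigits]
    simp [Real.ofDigits, Real.ofDigitsTerm, div_eq_mul_inv]
  · rw [iotaP_eq_ofDigits]
    exact ⟨Real.ofDigits_nonneg _, Real.ofDigits_le_one _⟩
  · exact (dimH_image_iotaP _).symm.trans (dimH_padicPathSet hf hG hreach hY)
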